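/- Let $n\ge 1$, let $\Gamma_+=\{\kappa\in\mathbb R^n:\kappa_i>0 \text{ for all } i\}$, and let $f:\Gamma_+\to\mathbb R$ be smooth, symmetric, strictly increasing in each argument ($\partial f/\partial\kappa_i>0$), homogeneous of degree one, positive, and normalised by $f(1,\dots,1)=1$. Put $f_*(x_1,\dots,x_n)=f(x_1^{-1},\dots,x_n^{-1})^{-1}$, extended continuously to $\overline{\Gamma_+}$, and $\hat f(x)=f(x,1,\dots,1)$ for $x>0$; let $\chi$ be the inverse function of $\hat f$. Consider the flow of hypersurfaces in $\mathbb R^{n+1}$ whose inward normal speed is $f(\kappa)$, where $\kappa$ is the vector of principal curvatures (the case $\alpha=1$). A smooth subsolution (supersolution) on $[a,b]$ is a family of closed sets with smooth boundary depending smoothly on time, with $\kappa\in\Gamma_+$ at each boundary point, and with inward normal velocity at least (at most) $f(\kappa)$. A family $(\Omega_t)_{0\le t\le T}$ of subsets of $\mathbb R^{n+1}$ is a barrier solution if for every $[a,b]\subset[0,T]$ each smooth subsolution $\Omega'$ on $[a,b]$ with $\Omega'_a\subset\Omega_a$ satisfies $\Omega'_t\subset\Omega_t$ on $[a,b]$,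 and each smooth supersolution $\Omega''$ on $[a,b]$ with $\Omega_a\subset\Omega''_a$ satisfies $\Omega_t\subset\Omega''_t$ on $[a,b]$. Write $M_t=\partial\Omega_t$ and $s(z,t)=\sup\{\langle y,z\rangle:y\in\Omega_t\}$ for $z\in\mathbb S^n$. Let $\Omega_0$ be bounded and convex with nonempty interior, and let $R_+$ be its circumradius. Flat sides move if and only if $f_*=0$ on $\partial\Gamma_+$, in the following sense. (1) If $f_*=0$ on $\partial\Gamma_+$, then for every barrier solution $(\Omega_t)_{0\le t\le T}$ and every $t\in(0,T]$ with $\Omega_t\neq\emptyset$, the set $\Omega_t$ is bounded, $3R_+^2/t$ lies in the range of $\hat f$, and for all $z\in\mathbb S^n$ $$s(z,t)\le s(z,0)-R_+\,3^{-\chi(3R_+^2/t)}.$$ (2) If $f_*$ does not vanish identically on $\partial\Gamma_+$, then there is a constant $C>0$, depending only on $f$, such that for every barrier solution $(\Omega_t)_{0\le t\le T}$: if $z\in\mathbb S^n$ and $y_0\in M_0$ satisfy $\langle y_0,z\rangle=s(z,0)$ and, for some $r>0$, the hemisphere $B_r(y_0)\cap\{y:\langle y,z\rangle<s(z,0)\}$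 is contained in $\Omega_0$, then $y_0\in M_t$ for $0\le t\le\min\{Cr^2,T\}$. -/

import Mathlib

open Set Filter Topology
open scoped ContDiff

noncomputable section

namespace CurvatureFlow

/-- The ambient Euclidean space `ℝⁿ⁺¹` of the evolving hypersurfaces. -/
abbrev Space (n : ℕ) : Type := EuclideanSpace ℝ (Fin (n + 1))

/-- The open positive cone in `ℝⁿ`. -/
def posCone (n : ℕ) : Set (Fin n → ℝ) := {κ | ∀ i, 0 < κ i}

/-- The standing conditions on the speed function `f`, a function on the positive cone (its values
elsewhere play no role): smooth, symmetric, strictly increasing in each argument, homogeneous of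
degree one, positive and normalised. -/
structure IsSpeed {n : ℕ} (f : (Fin n → ℝ) → ℝ) : Prop where
  smooth : ContDiffOn ℝ ∞ f (posCone n)
  symm : ∀ κ ∈ posCone n, ∀ σ : Equiv.Perm (Fin n), f (fun i => κ (σ i)) = f κ
  deriv_pos : ∀ κ ∈ posCone n, ∀ i, 0 < fderiv ℝ f κ (Pi.single i 1)
  homog : ∀ κ ∈ posCone n, ∀ c : ℝ, 0 < c → f (c • κ) = c * f κ
  pos : ∀ κ ∈ posCone n, 0 < f κ
  normalised : f (fun _ => 1) = 1

/-- The dual function `f_*(x₁, …, xₙ) = f(x₁⁻¹, …, xₙ⁻¹)⁻¹`. -/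
def dual {n : ℕ} (f : (Fin n → ℝ) → ℝ) (x : Fin n → ℝ) : ℝ := (f (fun i => (x i)⁻¹))⁻¹

/-- `f_*`, extended continuously from the positive cone to its closure, vanishes on the boundary of
the cone. -/
def DualVanishesOnBoundary {n : ℕ} (f : (Fin n → ℝ) → ℝ) : Prop :=
  ∀ x ∈ frontier (posCone n), Tendsto (dual f) (𝓝[posCone n] x) (𝓝 0)

/-- The function `x ↦ f(x, 1, …, 1)`. -/
def fhat {n : ℕ} (f : (Fin n → ℝ) → ℝ) (x : ℝ) : ℝ := f (fun i => if (i : ℕ) = 0 then x else 1)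

/-- `χ`, the inverse of the function `fhat f : (0, ∞) → ℝ`, with an arbitrary value outside the
range of that function. -/
def chi {n : ℕ} (f : (Fin n → ℝ) → ℝ) (ξ : ℝ) : ℝ := Function.invFunOn (fhat f) (Ioi 0) ξ

/-- `Ω` is a family of sets (only the times in `[a, b]` matter), `t ∈ [a, b]`, and `p` is a point of
`∂(Ω t)`. The predicate says that near `(p, t)` the family is the sublevel set `{φ ≤ 0}` of
a smooth function `φ` of space and time with non-vanishing spatial gradient (so near `p` the sets
have a smooth boundary, depending smoothly on time), that `κ` are the principal curvatures of
`∂(Ω t)` at `p`, listed in some order, and that `V` is the inward normal velocity there.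

The outer unit normal is `∇φ / ‖∇φ‖`, the second fundamental form is the restriction of
`D²φ / ‖∇φ‖` to the tangent space (positive on the boundary of a ball), `e` is an
orthonormal basis of principal directions of the tangent space, and the inward velocity is
`∂ₜφ / ‖∇φ‖`. -/
def HasBoundaryData {n : ℕ} (Ω : ℝ → Set (Space n)) (a b : ℝ) (p : Space n) (t : ℝ)
    (κ : Fin n → ℝ) (V : ℝ) : Prop :=
  ∃ (φ : Space n × ℝ → ℝ) (U : Set (Space n × ℝ)),
    IsOpen U ∧ (p, t) ∈ U ∧ ContDiffOn ℝ ∞ φ U ∧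
    (∀ q ∈ U, q.2 ∈ Icc a b → (q.1 ∈ Ω q.2 ↔ φ q ≤ 0)) ∧
    φ (p, t) = 0 ∧
    gradient (fun x => φ (x, t)) p ≠ 0 ∧
    (∃ e : Fin n → Space n, Orthonormal ℝ e ∧
      (∀ i, inner ℝ (gradient (fun x => φ (x, t)) p) (e i) = 0) ∧
      ∀ i j, fderiv ℝ (fderiv ℝ (fun x => φ (x, t))) p (e i) (e j) =
        if i = j then κ i * ‖gradient (fun x => φ (x, t)) p‖ else 0) ∧
    V = deriv (fun τ => φ (p, τ)) t / ‖gradient (fun x => φ (x, t)) p‖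

/-- A family of closed sets over the time interval `[a, b]` with smooth boundary depending smoothly
on time, whose principal curvatures `κ` lie in the positive cone and whose inward normal velocity
`V` satisfies `rel V κ` at each boundary point. The fields `inside` and `outside` say that no part
of a set appears or disappears suddenly: interior and exterior points remain so for nearby times. -/
structure IsSmoothEvolution {n : ℕ} (rel : ℝ → (Fin n → ℝ) → Prop) (Ω : ℝ → Set (Space n))
    (a b : ℝ) : Prop where
  closed : ∀ t ∈ Icc a b, IsClosed (Ω t)
  inside : ∀ t ∈ Icc a b, ∀ p ∈ interior (Ω t),
    ∀ᶠ q : Space n × ℝ in 𝓝 (p, t), q.2 ∈ Icc a b → q.1 ∈ Ω q.2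
  outside : ∀ t ∈ Icc a b, ∀ p ∉ Ω t,
    ∀ᶠ q : Space n × ℝ in 𝓝 (p, t), q.2 ∈ Icc a b → q.1 ∉ Ω q.2
  boundary : ∀ t ∈ Icc a b, ∀ p ∈ frontier (Ω t),
    ∃ (κ : Fin n → ℝ) (V : ℝ), HasBoundaryData Ω a b p t κ V ∧ κ ∈ posCone n ∧ rel V κ

/-- Smooth subsolutions of the flow with speed `f`: the inward normal velocity is at least
`f(κ)`. -/
def IsSubsolution {n : ℕ} (f : (Fin n → ℝ) → ℝ) (Ω : ℝ → Set (Space n)) (a b : ℝ) : Prop :=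
  IsSmoothEvolution (fun V κ => f κ ≤ V) Ω a b

/-- Smooth supersolutions of the flow with speed `f`: the inward normal velocity is at most
`f(κ)`. -/
def IsSupersolution {n : ℕ} (f : (Fin n → ℝ) → ℝ) (Ω : ℝ → Set (Space n)) (a b : ℝ) : Prop :=
  IsSmoothEvolution (fun V κ => V ≤ f κ) Ω a b

/-- Outer barriers on a time interval `I`: a smooth subsolution that starts inside stays inside. -/
def IsOuterBarrier {n : ℕ} (f : (Fin n → ℝ) → ℝ) (A : ℝ → Set (Space n)) (I : Set ℝ) : Prop :=
  ∀ a b : ℝ, a < b → Icc a b ⊆ I → ∀ Ω : ℝ → Set (Space n), IsSubsolution f Ω a b →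
    Ω a ⊆ A a → ∀ t ∈ Icc a b, Ω t ⊆ A t

/-- Inner barriers on a time interval `I`: they stay inside each smooth supersolution in which they
start. -/
def IsInnerBarrier {n : ℕ} (f : (Fin n → ℝ) → ℝ) (A : ℝ → Set (Space n)) (I : Set ℝ) : Prop :=
  ∀ a b : ℝ, a < b → Icc a b ⊆ I → ∀ Ω : ℝ → Set (Space n), IsSupersolution f Ω a b →
    A a ⊆ Ω a → ∀ t ∈ Icc a b, A t ⊆ Ω t

/-- Barrier solutions of the flow with speed `f` on a time interval `I`. -/
def IsBarrierSolution {n : ℕ} (f : (Fin n → ℝ) → ℝ) (A : ℝ → Set (Space n)) (I : Set ℝ) : Prop :=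
  IsOuterBarrier f A I ∧ IsInnerBarrier f A I

/-- The support function `s(z) = sup {⟨y, z⟩ : y ∈ K}` of a bounded nonempty set. -/
def supportFn {n : ℕ} (K : Set (Space n)) (z : Space n) : ℝ :=
  sSup ((fun y => inner ℝ y z) '' K)

/-- The circumradius of a bounded set: the infimum of the radii of the balls that contain it. -/
def circumradius {n : ℕ} (K : Set (Space n)) : ℝ :=
  sInf {R : ℝ | 0 ≤ R ∧ ∃ c : Space n, K ⊆ Metric.closedBall c R}

end CurvatureFlow

end

/-! Everything reduces to whether `fhat f` is bounded. If the dual vanishes on the boundary of the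
cone, its values at `(ε, 1, …, 1)` give `fhat f x → ∞`; if it does not, monotonicity and symmetry
bound `fhat f` by a constant `K`. Both halves then compare with hypersurfaces of revolution, which
have one meridian curvature and `n - 1` equal rotational ones.

Bounded case: on an ellipsoid of revolution `f(κ)` is at most `K` times the rotational curvature.
The sections may therefore shrink by `2K` per unit time in squared radius, however flat the
ellipsoid is (`isSubsolution_ellipsoid`). Flat ellipsoids inside the half-ball, approaching the flat
side, survive for a time of order `r²`. Large balls keep the solution in the supporting half-space
(`IsInnerBarrier.inner_le`), so `y₀` stays on the boundary.

Unbounded case: the barrier is the concave graph `y = k - a e^{μt} exp √(1 + l²s)`, with `s` the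
squared distance from the axis. Its meridian curvature is at most `χ` times the rotational one, so
`f(κ)` is at least `fhat f χ / χ` times the meridian curvature (`le_apply_axisVec`). With `fhat f χ
= 3R²/t` this exceeds the speed of the graph over the cylinder containing the solution. Outside the
cylinder the estimate fails, so a cutoff freezes the graph there; the perturbation is harmless over
short times and the argument is iterated (`IsInnerBarrier.subset_graph`). The amplitude grows by
`e^{χ/2}`, which pushes even the tip of the graph below the supporting plane
(`IsInnerBarrier.inner_le_neg`). The bound `χ ≥ 6` needed for the constants comes from extinction of
enclosing balls (`IsInnerBarrier.two_mul_le_sq`). -/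

namespace CurvatureFlow

/-! ### Speed functions and the boundedness of `fhat`. -/

/-- The vector `(x, y, …, y)`. -/
def axisVec {n : ℕ} (x y : ℝ) : Fin n → ℝ := fun i => if (i : ℕ) = 0 then x else y

theorem axisVec_mem {n : ℕ} {x y : ℝ} (hx : 0 < x) (hy : 0 < y) :
    (axisVec x y : Fin n → ℝ) ∈ posCone n := by
  intro i
  unfold axisVec
  split_ifs <;> assumption

theorem isOpen_posCone (n : ℕ) : IsOpen (posCone n) := by
  have : posCone n = ⋂ i, {κ : Fin n → ℝ | 0 < κ i} := by
    ext κ; simp [posCone]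
  rw [this]
  exact isOpen_iInter_of_finite fun i => isOpen_lt continuous_const (continuous_apply i)

namespace IsSpeed

variable {n : ℕ} {f : (Fin n → ℝ) → ℝ}

theorem mono (hf : IsSpeed f) {κ κ' : Fin n → ℝ} (h : κ ∈ posCone n) (hle : ∀ i, κ i ≤ κ' i) :
    f κ ≤ f κ' := by
  have h' : κ' ∈ posCone n := fun i => (h i).trans_le (hle i)
  have hmem : ∀ t ∈ Icc (0 : ℝ) 1, κ + t • (κ' - κ) ∈ posCone n := fun t ht i => by
    have h1 := h i
    have h2 := mul_nonneg ht.1 (sub_nonneg.2 (hle i))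
    simp only [Pi.add_apply, Pi.smul_apply, Pi.sub_apply, smul_eq_mul]
    linarith
  have hder : ∀ t ∈ Icc (0 : ℝ) 1, HasDerivAt (fun t : ℝ => f (κ + t • (κ' - κ)))
      (fderiv ℝ f (κ + t • (κ' - κ)) (κ' - κ)) t := fun t ht => by
    have hd : DifferentiableAt ℝ f (κ + t • (κ' - κ)) :=
      (hf.smooth.contDiffAt ((isOpen_posCone n).mem_nhds (hmem t ht))).differentiableAt (by simp)
    have hl : HasDerivAt (fun t : ℝ => κ + t • (κ' - κ)) (κ' - κ) t := by
      simpa using ((hasDerivAt_id t).smul_const (κ' - κ)).const_add κ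
    exact hd.hasFDerivAt.comp_hasDerivAt t hl
  have hm : MonotoneOn (fun t : ℝ => f (κ + t • (κ' - κ))) (Icc 0 1) := by
    refine monotoneOn_of_deriv_nonneg (convex_Icc 0 1)
      (fun t ht => (hder t ht).continuousAt.continuousWithinAt)
      (fun t ht => (hder t (interior_subset ht)).differentiableAt.differentiableWithinAt) ?_
    intro t ht
    have ht' := interior_subset ht
    rw [(hder t ht').deriv]
    have : κ' - κ = ∑ i, (κ' i - κ i) • Pi.single i (1 : ℝ) := by
      ext j
      simp [Finset.sum_apply, Pi.single_apply]
    rw [this, map_sum]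
    refine Finset.sum_nonneg fun i _ => ?_
    rw [map_smul, smul_eq_mul, ← this]
    exact mul_nonneg (sub_nonneg.2 (hle i)) (hf.deriv_pos _ (hmem t ht') i).le
  simpa using hm (left_mem_Icc.2 zero_le_one) (right_mem_Icc.2 zero_le_one) zero_le_one

theorem apply_axisVec (hf : IsSpeed f) {x y : ℝ} (hx : 0 < x) (hy : 0 < y) :
    f (axisVec x y) = y * fhat f (x / y) := by
  have h := hf.homog (axisVec (x / y) 1) (axisVec_mem (by positivity) one_pos) y hy
  rw [show fhat f (x / y) = f (axisVec (x / y) 1) from rfl, ← h]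
  congr 1
  ext i
  simp only [axisVec, Pi.smul_apply, smul_eq_mul]
  split_ifs
  · field_simp
  · simp

theorem fhat_one (hf : IsSpeed f) : fhat f 1 = 1 := by
  simpa [fhat] using hf.normalised

theorem fhat_mono (hf : IsSpeed f) {x y : ℝ} (hx : 0 < x) (hxy : x ≤ y) :
    fhat f x ≤ fhat f y := by
  refine hf.mono (κ := axisVec x 1) (κ' := axisVec y 1) (axisVec_mem hx one_pos) fun i => ?_
  unfold axisVec
  split_ifs <;> simp [hxy]

/-- Raising every entry to `x` gives `f(x, …, x) = x`. -/
theorem fhat_le_self (hf : IsSpeed f) {x : ℝ} (hx : 1 ≤ x) : fhat f x ≤ x := by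
  have hx0 : 0 < x := by linarith
  have h := hf.apply_axisVec hx0 hx0
  rw [div_self hx0.ne', hf.fhat_one, mul_one] at h
  refine le_of_le_of_eq ?_ h
  refine hf.mono (κ := axisVec x 1) (κ' := axisVec x x) (axisVec_mem hx0 one_pos) fun i => ?_
  unfold axisVec
  split_ifs <;> simp [hx]

theorem apply_const (hf : IsSpeed f) {x : ℝ} (hx : 0 < x) : f (axisVec x x) = x := by
  rw [hf.apply_axisVec hx hx, div_self hx.ne', hf.fhat_one, mul_one]

/-- If the first argument is at most `ξ` times the others, then the speed is at least the first
argument times `fhat f ξ / ξ`. -/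
theorem le_apply_axisVec (hf : IsSpeed f) {x y ξ : ℝ} (hx : 0 < x) (hξ : 0 < ξ) (h : x ≤ ξ * y) :
    x * fhat f ξ / ξ ≤ f (axisVec x y) := by
  have hd : 0 < x / ξ := by positivity
  -- Lowering the other entries from `y` to `x / ξ` makes the ratio exactly `ξ`, where homogeneity
  -- evaluates `f`.
  have h1 := hf.apply_axisVec hx hd
  rw [show x / (x / ξ) = ξ by field_simp] at h1
  rw [show x * fhat f ξ / ξ = x / ξ * fhat f ξ by ring, ← h1]
  refine hf.mono (axisVec_mem hx hd) fun i => ?_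
  simp only [axisVec]
  split_ifs
  · exact le_rfl
  · rw [div_le_iff₀ hξ]; linarith

theorem continuousOn_fhat (hf : IsSpeed f) : ContinuousOn (fhat f) (Ioi 0) := by
  refine hf.smooth.continuousOn.comp (t := posCone n) ?_
    fun x hx => axisVec_mem (n := n) hx one_pos
  refine Continuous.continuousOn (continuous_pi fun i => ?_)
  split_ifs <;> fun_prop

/-- The dual at `(ε, 1, …, 1)` is `1 / fhat f ε⁻¹`, and these points tend to the boundary point `(0,
1, …, 1)`. -/
theorem exists_lt_fhat (hf : IsSpeed f) (hn : 1 ≤ n) (hv : DualVanishesOnBoundary f) (M : ℝ) :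
    ∃ x, 0 < x ∧ M < fhat f x := by
  have hx0 : (axisVec 0 1 : Fin n → ℝ) ∉ posCone n := fun h => by
    have := h ⟨0, hn⟩
    simp [axisVec] at this
  have hlim : Tendsto (fun ε : ℝ => (axisVec ε 1 : Fin n → ℝ)) (𝓝[>] 0) (𝓝 (axisVec 0 1)) := by
    refine Tendsto.mono_left ?_ nhdsWithin_le_nhds
    refine tendsto_pi_nhds.2 fun i => ?_
    simp only [axisVec]
    split_ifs
    · exact tendsto_id
    · exact tendsto_const_nhds
  have hlim' : Tendsto (fun ε : ℝ => (axisVec ε 1 : Fin n → ℝ)) (𝓝[>] 0)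
      (𝓝[posCone n] (axisVec 0 1)) :=
    tendsto_nhdsWithin_iff.2
      ⟨hlim, eventually_mem_nhdsWithin.mono fun ε hε => axisVec_mem hε one_pos⟩
  have hfr : (axisVec 0 1 : Fin n → ℝ) ∈ frontier (posCone n) := by
    rw [(isOpen_posCone n).frontier_eq]
    refine ⟨mem_closure_of_tendsto hlim ?_, hx0⟩
    exact eventually_mem_nhdsWithin.mono fun ε hε => axisVec_mem hε one_pos
  have h0 := (hv _ hfr).comp hlim'
  have hM : 0 < (|M| + 1)⁻¹ := by positivity
  obtain ⟨ε, hε, hε0⟩ := ((h0.eventually (gt_mem_nhds hM)).and self_mem_nhdsWithin).exists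
  have hε0 : 0 < ε := hε0
  refine ⟨ε⁻¹, by positivity, ?_⟩
  have he : dual f (axisVec ε 1) = (fhat f ε⁻¹)⁻¹ := by
    unfold dual fhat axisVec
    congr 2
    ext i
    split_ifs <;> simp
  simp only [Function.comp_apply, he] at hε
  have hpos : 0 < fhat f ε⁻¹ := hf.pos _ (axisVec_mem (n := n) (inv_pos.2 hε0) one_pos)
  have := (inv_lt_inv₀ hpos (by positivity)).1 hε
  linarith [le_abs_self M]

theorem mem_range_fhat (hf : IsSpeed f) (hn : 1 ≤ n) (hv : DualVanishesOnBoundary f) {M : ℝ}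
    (hM : 1 ≤ M) : M ∈ fhat f '' Ioi 0 := by
  obtain ⟨x, hx, hxM⟩ := hf.exists_lt_fhat hn hv M
  have hsub : uIcc 1 x ⊆ Ioi (0 : ℝ) := fun y hy => by
    have : min 1 x ≤ y := hy.1
    exact (lt_min one_pos hx).trans_le this
  obtain ⟨y, hy, rfl⟩ := intermediate_value_uIcc (hf.continuousOn_fhat.mono hsub)
    (show M ∈ uIcc (fhat f 1) (fhat f x) by
      rw [hf.fhat_one]; exact ⟨(min_le_left _ _).trans hM, hxM.le.trans (le_max_right _ _)⟩)
  exact ⟨y, hsub hy, rfl⟩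

/-- Near a boundary point where the dual does not tend to zero there are `q` in the cone with
`f(q⁻¹) ≤ 1/δ`. Their entries are below `L` and one is arbitrarily small, so up to a permutation
`q⁻¹` dominates `(x/L, 1/L, …, 1/L)`, where `f` is `fhat f x / L`. -/
theorem exists_fhat_le (hf : IsSpeed f) (hv : ¬ DualVanishesOnBoundary f) :
    ∃ K, 1 ≤ K ∧ ∀ x, 0 < x → fhat f x ≤ K := by
  unfold DualVanishesOnBoundary at hv
  push Not at hv
  obtain ⟨p, hp, hlim⟩ := hv
  rw [(isOpen_posCone n).frontier_eq] at hp
  obtain ⟨i₀, hi₀⟩ : ∃ i, p i ≤ 0 := by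
    by_contra! h
    exact hp.2 h
  rw [Metric.tendsto_nhds] at hlim
  push Not at hlim
  obtain ⟨δ, hδ, hfreq⟩ := hlim
  set L : ℝ := ∑ i, |p i| + 1 with hL
  have hLp : ∀ i, p i < L := fun i => by
    have := Finset.single_le_sum (fun j _ => abs_nonneg (p j)) (Finset.mem_univ i)
    linarith [le_abs_self (p i)]
  have hL0 : 0 < L := by positivity
  have key : ∀ x, 0 < x → fhat f x ≤ L / δ := fun x hx => by
    have hev : ∀ᶠ q in 𝓝[posCone n] p, (∀ i, q i < L) ∧ q i₀ < L / x := by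
      refine nhdsWithin_le_nhds ?_
      refine (eventually_all.2 fun i => ?_).and ?_
      · exact (continuous_apply i).continuousAt.eventually (gt_mem_nhds (hLp i))
      · exact (continuous_apply i₀).continuousAt.eventually
          (gt_mem_nhds (hi₀.trans_lt (by positivity)))
    obtain ⟨q, hq, ⟨hqL, hq0⟩, hqc⟩ := (hfreq.and_eventually
      (hev.and eventually_mem_nhdsWithin)).exists
    have hqi : (fun i => (q i)⁻¹) ∈ posCone n := fun i => inv_pos.2 (hqc i)
    have hfq := hf.pos _ hqi
    have h1 : f (fun i => (q i)⁻¹) ≤ δ⁻¹ := by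
      rw [Real.dist_eq, sub_zero, dual, abs_of_pos (inv_pos.2 hfq)] at hq
      exact (le_inv_comm₀ hδ hfq).1 hq
    have hn : 0 < n := i₀.pos
    let σ : Equiv.Perm (Fin n) := Equiv.swap ⟨0, hn⟩ i₀
    have h2 : f (axisVec (x / L) (1 / L)) ≤ f (fun i => (q i)⁻¹) := by
      rw [← hf.symm _ hqi σ]
      refine hf.mono (axisVec_mem (by positivity) (by positivity)) fun i => ?_
      simp only [axisVec]
      split_ifs with h
      · have : i = ⟨0, hn⟩ := Fin.ext h
        subst this
        simp only [σ, Equiv.swap_apply_left]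
        rw [← inv_div]
        exact (inv_le_inv₀ (by positivity) (hqc i₀)).2 hq0.le
      · rw [one_div]
        exact (inv_le_inv₀ hL0 (hqc _)).2 (hqL _).le
    rw [hf.apply_axisVec (by positivity) (by positivity),
      show x / L / (1 / L) = x by field_simp] at h2
    have h3 := h2.trans h1
    rw [div_mul_eq_mul_div, one_mul, div_le_iff₀ hL0] at h3
    rw [div_eq_mul_inv, mul_comm]; exact h3
  exact ⟨L / δ, by simpa [hf.fhat_one] using key 1 one_pos, key⟩

theorem chi_spec {ξ : ℝ} (hξ : ξ ∈ fhat f '' Ioi 0) : 0 < chi f ξ ∧ fhat f (chi f ξ) = ξ :=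
  ⟨Function.invFunOn_mem hξ, Function.invFunOn_eq hξ⟩

/-- Above `1` the function `fhat f` lies below the identity, so a preimage lies above it; preimages
at most `1` only give values at most `1`. -/
theorem le_chi (hf : IsSpeed f) {ξ : ℝ} (h1 : 1 < ξ) (hξ : ξ ∈ fhat f '' Ioi 0) :
    ξ ≤ chi f ξ := by
  obtain ⟨h0, h⟩ := chi_spec hξ
  rcases le_total 1 (chi f ξ) with hc | hc
  · exact h.symm.le.trans (hf.fhat_le_self hc)
  · have := hf.fhat_mono h0 hc
    rw [h, hf.fhat_one] at this
    linarith

end IsSpeed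

end CurvatureFlow

/-! ### Geometry of hypersurfaces of revolution. -/

namespace CurvatureFlow

section Rotational

variable {E : Type*} [NormedAddCommGroup E] [InnerProductSpace ℝ E]

/-- The component orthogonal to `z`, as a continuous linear map. -/
noncomputable def orthComp (z : E) : E →L[ℝ] E :=
  ContinuousLinearMap.id ℝ E - (innerSL ℝ z).smulRight z

/-- The squared distance of `p` from the line through `c` with direction `z`. -/
noncomputable def axisDistSq (c z p : E) : ℝ := ‖orthComp z (p - c)‖ ^ 2

theorem orthComp_apply (z v : E) : orthComp z v = v - inner ℝ z v • z := by
  simp [orthComp]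

theorem inner_orthComp_self {z : E} (hz : ‖z‖ = 1) (v : E) : inner ℝ z (orthComp z v) = 0 := by
  rw [orthComp_apply, inner_sub_right, inner_smul_right, real_inner_self_eq_norm_sq, hz]
  ring

theorem inner_orthComp_orthComp {z : E} (hz : ‖z‖ = 1) (v w : E) :
    inner ℝ (orthComp z v) (orthComp z w) = inner ℝ (orthComp z v) w := by
  rw [orthComp_apply z w, inner_sub_right, inner_smul_right, real_inner_comm,
    real_inner_comm z (orthComp z v), inner_orthComp_self hz]
  ring

theorem axisDistSq_nonneg (c z p : E) : 0 ≤ axisDistSq c z p := by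
  unfold axisDistSq; positivity

theorem axisDistSq_add_sq {z : E} (hz : ‖z‖ = 1) (c p : E) :
    axisDistSq c z p + inner ℝ z (p - c) ^ 2 = ‖p - c‖ ^ 2 := by
  unfold axisDistSq
  rw [← real_inner_self_eq_norm_sq, inner_orthComp_orthComp hz, orthComp_apply, inner_sub_left,
    inner_smul_left, real_inner_self_eq_norm_sq]
  simp only [conj_trivial]
  ring

theorem hasFDerivAt_axisDistSq {z : E} (hz : ‖z‖ = 1) (c p : E) :
    HasFDerivAt (axisDistSq c z) (2 • innerSL ℝ (orthComp z (p - c))) p := by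
  have h1 : HasFDerivAt (fun p => orthComp z (p - c)) (orthComp z) p :=
    (orthComp z).hasFDerivAt.comp p ((hasFDerivAt_id p).sub_const c)
  refine h1.norm_sq.congr_fderiv ?_
  ext v
  simp [inner_orthComp_orthComp hz]

theorem contDiff_axisDistSq (c z : E) : ContDiff ℝ ∞ (axisDistSq c z) := by
  unfold axisDistSq
  exact ((orthComp z).contDiff.comp (contDiff_id.sub contDiff_const)).norm_sq ℝ

theorem hasFDerivAt_height (c z p : E) :
    HasFDerivAt (fun p => inner ℝ z (p - c)) (innerSL ℝ z) p := by
  have := (innerSL ℝ z).hasFDerivAt.comp p ((hasFDerivAt_id p).sub_const c)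
  exact this

variable {c z : E} {G G₁ H H₁ : ℝ → ℝ} {G₂ H₂ : ℝ}

theorem hasFDerivAt_rotational (hz : ‖z‖ = 1)
    (hG : ∀ s, 0 ≤ s → HasDerivAt G (G₁ s) s) (hH : ∀ y, HasDerivAt H (H₁ y) y) (p : E) :
    HasFDerivAt (fun p => G (axisDistSq c z p) + H (inner ℝ z (p - c)))
      (G₁ (axisDistSq c z p) • (2 • innerSL ℝ (orthComp z (p - c))) +
        H₁ (inner ℝ z (p - c)) • innerSL ℝ z) p :=
  ((hG _ (axisDistSq_nonneg c z p)).comp_hasFDerivAt p (hasFDerivAt_axisDistSq hz c p)).add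
    ((hH _).comp_hasFDerivAt p (hasFDerivAt_height c z p))

/-- Differentiability of `G` is asked only for `s ≥ 0`, the range of the squared distance, because
the exponential profile contains a square root. -/
theorem fderiv_fderiv_rotational (hz : ‖z‖ = 1)
    (hG : ∀ s, 0 ≤ s → HasDerivAt G (G₁ s) s) (hH : ∀ y, HasDerivAt H (H₁ y) y) (p : E)
    (hG₂ : HasDerivAt G₁ G₂ (axisDistSq c z p)) (hH₂ : HasDerivAt H₁ H₂ (inner ℝ z (p - c)))
    (v w : E) :
    fderiv ℝ (fderiv ℝ fun p => G (axisDistSq c z p) + H (inner ℝ z (p - c))) p v w =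
      2 * G₁ (axisDistSq c z p) * inner ℝ (orthComp z v) w +
      4 * G₂ * inner ℝ (orthComp z (p - c)) v * inner ℝ (orthComp z (p - c)) w +
      H₂ * inner ℝ z v * inner ℝ z w := by
  have h1 : (fderiv ℝ fun p => G (axisDistSq c z p) + H (inner ℝ z (p - c))) =
      fun p => G₁ (axisDistSq c z p) • (2 • innerSL ℝ (orthComp z (p - c))) +
        H₁ (inner ℝ z (p - c)) • innerSL ℝ z :=
    funext fun p => (hasFDerivAt_rotational hz hG hH p).fderiv
  have h2 : HasFDerivAt (fun p => 2 • innerSL ℝ (orthComp z (p - c)))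
      (2 • (innerSL ℝ).comp (orthComp z)) p := by
    have : HasFDerivAt (fun p => orthComp z (p - c)) (orthComp z) p :=
      (orthComp z).hasFDerivAt.comp p ((hasFDerivAt_id p).sub_const c)
    exact ((innerSL ℝ).hasFDerivAt.comp p this).const_smul 2
  have h3 := ((hG₂.comp_hasFDerivAt p (hasFDerivAt_axisDistSq hz c p)).smul h2).add
    ((hH₂.comp_hasFDerivAt p (hasFDerivAt_height c z p)).smul_const (innerSL ℝ z))
  rw [h1]
  erw [h3.fderiv]
  simp [-map_sub]
  ring

end Rotational

variable {n : ℕ}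

/-- An orthonormal basis whose last vector is `z`, and for which `x` is a multiple of the first
one. -/
theorem exists_orthonormalBasis_axis (hn : 1 ≤ n) {z x : Space n} (hz : ‖z‖ = 1)
    (hx : inner ℝ z x = 0) :
    ∃ b : OrthonormalBasis (Fin (n + 1)) ℝ (Space n), b (Fin.last n) = z ∧ x = ‖x‖ • b 0 := by
  have h0 : (0 : Fin (n + 1)) ≠ Fin.last n := by
    intro h
    have := congrArg Fin.val h
    simp at this
    omega
  have hcard : Module.finrank ℝ (Space n) = Fintype.card (Fin (n + 1)) := by simp
  by_cases hx0 : x = 0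
  · obtain ⟨b, hb⟩ := Orthonormal.exists_orthonormalBasis_extension_of_card_eq hcard
      (v := fun _ => z) (s := {Fin.last n}) (by
        refine ⟨fun i => hz, fun i j hij => (hij (Subsingleton.elim _ _)).elim⟩)
    exact ⟨b, hb _ rfl, by simp [hx0]⟩
  · have hxn : ‖x‖ ≠ 0 := norm_ne_zero_iff.2 hx0
    obtain ⟨b, hb⟩ := Orthonormal.exists_orthonormalBasis_extension_of_card_eq hcard
      (v := fun i => if i = 0 then ‖x‖⁻¹ • x else z) (s := {0, Fin.last n}) (by
        refine ⟨fun i => ?_, fun i j hij => ?_⟩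
        · simp only [Set.domRestrict_apply]
          split_ifs
          · rw [norm_smul, norm_inv, norm_norm, inv_mul_cancel₀ hxn]
          · exact hz
        · obtain ⟨i, hi⟩ := i
          obtain ⟨j, hj⟩ := j
          simp only [ne_eq, Subtype.mk.injEq] at hij
          simp only [Set.domRestrict_apply]
          simp only [mem_insert_iff, mem_singleton_iff] at hi hj
          rcases hi with rfl | rfl <;> rcases hj with rfl | rfl
          · exact (hij rfl).elim
          · simp [h0.symm, inner_smul_left, real_inner_comm, hx]
          · simp [h0.symm, inner_smul_right, hx]
          · exact (hij rfl).elim)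
    refine ⟨b, ?_, ?_⟩
    · rw [hb _ (by simp)]; simp [h0.symm]
    · rw [hb _ (by simp)]; simp [smul_smul, mul_inv_cancel₀ hxn]

/-- Principal curvatures and normal velocity of a family of hypersurfaces of revolution with axis
through `c` in direction `z`, given as level sets of `g (s, t) + h (y, t)`, where `s` is the squared
distance from the axis and `y` the height along it. -/
theorem hasBoundaryData_rotational (hn : 1 ≤ n) {Ω : ℝ → Set (Space n)} {a b t : ℝ}
    {c z p : Space n} (hz : ‖z‖ = 1) {g h : ℝ → ℝ → ℝ} {G₁ H₁ : ℝ → ℝ} {G₂ H₂ gt ht : ℝ}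
    (hsm : ContDiff ℝ ∞ fun q : Space n × ℝ =>
      g (axisDistSq c z q.1) q.2 + h (inner ℝ z (q.1 - c)) q.2)
    (hΩ : ∀ q : Space n, ∀ τ ∈ Icc a b,
      (q ∈ Ω τ ↔ g (axisDistSq c z q) τ + h (inner ℝ z (q - c)) τ ≤ 0))
    (hp : g (axisDistSq c z p) t + h (inner ℝ z (p - c)) t = 0)
    (hG : ∀ s, 0 ≤ s → HasDerivAt (fun s => g s t) (G₁ s) s)
    (hH : ∀ y, HasDerivAt (fun y => h y t) (H₁ y) y)
    (hG₂ : HasDerivAt G₁ G₂ (axisDistSq c z p)) (hH₂ : HasDerivAt H₁ H₂ (inner ℝ z (p - c)))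
    (hgt : HasDerivAt (fun τ => g (axisDistSq c z p) τ) gt t)
    (hht : HasDerivAt (fun τ => h (inner ℝ z (p - c)) τ) ht t)
    {s g₁ h₁ N : ℝ} (hs : s = axisDistSq c z p) (hg₁ : g₁ = G₁ s)
    (hh₁ : h₁ = H₁ (inner ℝ z (p - c))) (hN : N = √(4 * s * g₁ ^ 2 + h₁ ^ 2)) (hN0 : 0 < N) :
    HasBoundaryData Ω a b p t
      (axisVec (((2 * g₁ + 4 * s * G₂) * h₁ ^ 2 + 4 * s * g₁ ^ 2 * H₂) / N ^ 3) (2 * g₁ / N))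
      ((gt + ht) / N) := by
  set x : Space n := orthComp z (p - c) with hx
  have hzx : inner ℝ z x = 0 := inner_orthComp_self hz _
  have hxz : inner ℝ x z = 0 := by rw [real_inner_comm, hzx]
  obtain ⟨B, hBz, hBx⟩ := exists_orthonormalBasis_axis hn hz hzx
  have hs' : s = ‖x‖ ^ 2 := hs
  have hs0 : 0 ≤ s := hs' ▸ sq_nonneg _
  have hN2 : N ^ 2 = 4 * s * g₁ ^ 2 + h₁ ^ 2 := by
    rw [hN, Real.sq_sqrt (by positivity)]
  have hgrad : gradient (fun q => g (axisDistSq c z q) t + h (inner ℝ z (q - c)) t) p =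
      (2 * g₁) • x + h₁ • z := by
    refine ext_inner_right ℝ fun v => ?_
    rw [gradient, InnerProductSpace.toDual_symm_apply,
      (hasFDerivAt_rotational hz hG hH p).fderiv, inner_add_left, inner_smul_left, inner_smul_left,
      ← hs, ← hg₁, ← hh₁]
    simp [← hx]
    ring
  have hBij : ∀ i j, inner ℝ (B i) (B j) = if i = j then (1 : ℝ) else 0 :=
    fun i j => orthonormal_iff_ite.1 B.orthonormal i j
  have h0l : (0 : Fin (n + 1)) ≠ Fin.last n := by
    intro h
    have := congrArg Fin.val h
    simp at this
    omega
  have hzB : ∀ i, inner ℝ z (B i) = if i = Fin.last n then (1 : ℝ) else 0 := fun i => by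
    rw [← hBz, hBij]; simp [eq_comm]
  have hxB : ∀ i, inner ℝ x (B i) = if i = 0 then ‖x‖ else 0 := fun i => by
    rw [show inner ℝ x (B i) = inner ℝ (‖x‖ • B 0) (B i) from congrArg (inner ℝ · (B i)) hBx,
      inner_smul_left, hBij]
    by_cases hi : i = 0
    · subst hi; simp
    · simp [hi, Ne.symm hi]
  have hnorm : ‖gradient (fun q => g (axisDistSq c z q) t + h (inner ℝ z (q - c)) t) p‖ = N := by
    rw [hgrad, hN, ← Real.sqrt_sq (norm_nonneg _), ← real_inner_self_eq_norm_sq]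
    congr 1
    simp only [inner_add_left, inner_add_right, inner_smul_left, inner_smul_right,
      real_inner_self_eq_norm_sq, hz, hzx, hxz, conj_trivial, hs']
    ring
  -- `α` and `β` are the coordinates of the unit meridian tangent, orthogonal to the gradient `2 g₁
  -- x + h₁ z`. It takes slot `0`; the remaining directions are orthogonal to both `x` and `z`.
  set α : ℝ := h₁ / N with hα
  set β : ℝ := -(2 * g₁ * ‖x‖) / N with hβ
  have hαβ : α ^ 2 + β ^ 2 = 1 := by
    rw [hα, hβ]
    field_simp
    rw [hN2, hs']; ring
  let e : Fin n → Space n := fun i =>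
    if (i : ℕ) = 0 then α • B 0 + β • B (Fin.last n) else B i.castSucc
  have hcs : ∀ i : Fin n, (i.castSucc : Fin (n + 1)) ≠ Fin.last n := fun i => i.castSucc_ne_last
  have hc0 : ∀ i : Fin n, (i : ℕ) ≠ 0 → (i.castSucc : Fin (n + 1)) ≠ 0 := fun i hi h => by
    apply hi
    simpa using congrArg Fin.val h
  have hze : ∀ i, inner ℝ z (e i) = if (i : ℕ) = 0 then β else 0 := fun i => by
    simp only [e]
    split_ifs with hi
    · simp [inner_add_right, inner_smul_right, hzB, h0l]
    · simp [hzB, hcs]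
  have hxe : ∀ i, inner ℝ x (e i) = if (i : ℕ) = 0 then α * ‖x‖ else 0 := fun i => by
    simp only [e]
    split_ifs with hi
    · simp [inner_add_right, inner_smul_right, hxB, h0l.symm]
    · simp [hxB, hc0 i hi]
  have hee : ∀ i j, inner ℝ (e i) (e j) = if i = j then (1 : ℝ) else 0 := fun i j => by
    simp only [e]
    by_cases hi : (i : ℕ) = 0 <;> by_cases hj : (j : ℕ) = 0
    · have : i = j := Fin.ext (hi.trans hj.symm)
      simp only [hj, this, if_true, inner_add_left, inner_add_right, inner_smul_left,
        inner_smul_right, hBij, h0l, h0l.symm, conj_trivial, if_false]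
      linarith
    · have : i ≠ j := fun h => hj (h ▸ hi)
      simp [hi, hj, this, inner_add_left, inner_smul_left, hBij, (hc0 j hj).symm, (hcs j).symm]
    · have : i ≠ j := fun h => hi (h ▸ hj)
      simp [hi, hj, this, inner_add_right, inner_smul_right, hBij, hc0 i hi, hcs i]
    · simp [hi, hj, hBij]
  refine ⟨fun q => g (axisDistSq c z q.1) q.2 + h (inner ℝ z (q.1 - c)) q.2, univ, isOpen_univ,
    mem_univ _, hsm.contDiffOn, fun q _ hq => hΩ q.1 q.2 hq, hp, ?_, ⟨e, ?_, ?_, ?_⟩, ?_⟩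
  · intro h0
    rw [h0, norm_zero] at hnorm
    exact hN0.ne hnorm
  · exact orthonormal_iff_ite.2 hee
  · intro i
    simp only [hgrad, inner_add_left, inner_smul_left, hze, hxe, conj_trivial]
    split_ifs
    · rw [hα, hβ]; ring
    · simp
  · intro i j
    simp only [hnorm]
    rw [fderiv_fderiv_rotational hz hG hH p hG₂ hH₂, orthComp_apply, inner_sub_left,
      inner_smul_left, hee, hze, hze, ← hx, hxe, hxe, ← hs, ← hg₁]
    simp only [conj_trivial, axisVec]
    by_cases hi : (i : ℕ) = 0
    · by_cases hj : (j : ℕ) = 0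
      · have : i = j := Fin.ext (hi.trans hj.symm)
        simp only [hj, this, if_true]
        have h1 : 1 - β * β = α ^ 2 := by rw [← hαβ]; ring
        have hβ2 : β * β = 4 * s * g₁ ^ 2 / N ^ 2 := by rw [hβ, hs']; ring
        have hα2 : α ^ 2 = h₁ ^ 2 / N ^ 2 := by rw [hα]; ring
        calc _ = 2 * g₁ * (1 - β * β) + 4 * G₂ * ‖x‖ ^ 2 * α ^ 2 + H₂ * (β * β) := by ring
          _ = _ := by
            rw [h1, hβ2, hα2, ← hs']
            field_simp
      · have : i ≠ j := fun h => hj (h ▸ hi)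
        simp [hi, hj, this]
    · by_cases hij : i = j
      · subst hij
        simp only [hi, if_false, if_true]
        field_simp
        ring
      · simp [hi, hij]
  · simp only [hnorm]
    rw [(hgt.fun_add hht).deriv]

end CurvatureFlow

/-! ### Level-set evolutions; balls and ellipsoids as barriers. -/

namespace CurvatureFlow

variable {n : ℕ}

/-- At an interior point the defining function, being zero there and nonpositive nearby, would have
a local maximum and hence zero gradient. -/
theorem HasBoundaryData.notMem_interior {Ω : ℝ → Set (Space n)} {a b t V : ℝ} {p : Space n}
    {κ : Fin n → ℝ} (h : HasBoundaryData Ω a b p t κ V) (ht : t ∈ Icc a b) :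
    p ∉ interior (Ω t) := by
  intro hp
  obtain ⟨φ, U, hU, hpU, -, hΩ, h0, hgrad, -⟩ := h
  apply hgrad
  have hmax : IsLocalMax (fun x => φ (x, t)) p := by
    have h1 : ∀ᶠ x in 𝓝 p, (x, t) ∈ U :=
      (Continuous.prodMk_left t).continuousAt.eventually (hU.mem_nhds hpU)
    filter_upwards [h1, mem_interior_iff_mem_nhds.1 hp] with x hx hx'
    rw [h0]
    exact (hΩ (x, t) hx ht).1 hx'
  rw [gradient, hmax.fderiv_eq_zero, map_zero]

theorem isSmoothEvolution_levelSet {rel : ℝ → (Fin n → ℝ) → Prop} {φ : Space n × ℝ → ℝ} {a b : ℝ}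
    (hφ : Continuous φ)
    (hb : ∀ t ∈ Icc a b, ∀ p, φ (p, t) = 0 → ∃ (κ : Fin n → ℝ) (V : ℝ),
      HasBoundaryData (fun t => {p | φ (p, t) ≤ 0}) a b p t κ V ∧ κ ∈ posCone n ∧ rel V κ) :
    IsSmoothEvolution rel (fun t => {p | φ (p, t) ≤ 0}) a b where
  closed t _ := isClosed_le (hφ.comp (Continuous.prodMk_left t)) continuous_const
  inside t ht p hp := by
    have h1 : p ∈ {p | φ (p, t) ≤ 0} := interior_subset hp
    change φ (p, t) ≤ 0 at h1
    rcases h1.lt_or_eq with h1 | h1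
    · filter_upwards [hφ.continuousAt.eventually (gt_mem_nhds h1)] with q hq _ using le_of_lt hq
    · obtain ⟨κ, V, h, -⟩ := hb t ht p h1
      exact absurd hp (h.notMem_interior ht)
  outside t ht p hp := by
    have h1 : 0 < φ (p, t) := not_le.1 hp
    filter_upwards [hφ.continuousAt.eventually (lt_mem_nhds h1)] with q hq _ using not_le.2 hq
  boundary t ht p hp :=
    hb t ht p (frontier_le_subset_eq (hφ.comp (Continuous.prodMk_left t)) continuous_const hp)

theorem isSmoothEvolution_rotational (hn : 1 ≤ n) {rel : ℝ → (Fin n → ℝ) → Prop} {a b : ℝ}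
    {c z : Space n} (hz : ‖z‖ = 1) {g g₁ g₂ gt h h₁ h₂ ht : ℝ → ℝ → ℝ}
    (hsm : ContDiff ℝ ∞ fun q : Space n × ℝ =>
      g (axisDistSq c z q.1) q.2 + h (inner ℝ z (q.1 - c)) q.2)
    (hg₁ : ∀ t ∈ Icc a b, ∀ s, 0 ≤ s → HasDerivAt (fun s => g s t) (g₁ s t) s)
    (hg₂ : ∀ t ∈ Icc a b, ∀ s, 0 ≤ s → HasDerivAt (fun s => g₁ s t) (g₂ s t) s)
    (hgt : ∀ t ∈ Icc a b, ∀ s, 0 ≤ s → HasDerivAt (fun t => g s t) (gt s t) t)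
    (hh₁ : ∀ t ∈ Icc a b, ∀ y, HasDerivAt (fun y => h y t) (h₁ y t) y)
    (hh₂ : ∀ t ∈ Icc a b, ∀ y, HasDerivAt (fun y => h₁ y t) (h₂ y t) y)
    (hht : ∀ t ∈ Icc a b, ∀ y, HasDerivAt (fun t => h y t) (ht y t) t)
    (hrel : ∀ t ∈ Icc a b, ∀ s, 0 ≤ s → ∀ y, g s t + h y t = 0 →
      0 < g₁ s t ∧
      0 < (2 * g₁ s t + 4 * s * g₂ s t) * h₁ y t ^ 2 + 4 * s * g₁ s t ^ 2 * h₂ y t ∧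
      ∀ N, 0 < N → N ^ 2 = 4 * s * g₁ s t ^ 2 + h₁ y t ^ 2 →
        rel ((gt s t + ht y t) / N)
          (axisVec (((2 * g₁ s t + 4 * s * g₂ s t) * h₁ y t ^ 2 + 4 * s * g₁ s t ^ 2 * h₂ y t)
            / N ^ 3) (2 * g₁ s t / N))) :
    IsSmoothEvolution rel
      (fun t => {p | g (axisDistSq c z p) t + h (inner ℝ z (p - c)) t ≤ 0}) a b := by
  refine isSmoothEvolution_levelSet hsm.continuous fun t htI p hp => ?_
  have hs := axisDistSq_nonneg c z p
  obtain ⟨hpos, hpos', hr⟩ := hrel t htI _ hs _ hp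
  set s := axisDistSq c z p
  set y : ℝ := inner ℝ z (p - c)
  have hQ0 : 0 ≤ 4 * s * g₁ s t ^ 2 + h₁ y t ^ 2 := by positivity
  -- The squared gradient cannot vanish: both of its terms are factors in the positive meridian
  -- numerator.
  have hQ : 0 < 4 * s * g₁ s t ^ 2 + h₁ y t ^ 2 := by
    refine hQ0.lt_of_ne fun h0 => ?_
    have e1 : 0 ≤ 4 * s * g₁ s t ^ 2 := by positivity
    have e2 : 0 ≤ h₁ y t ^ 2 := by positivity
    have e3 : 4 * s * g₁ s t ^ 2 = 0 := by linarith
    have e4 : h₁ y t ^ 2 = 0 := by linarith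
    rw [e3, e4] at hpos'
    simp at hpos'
  have hN : 0 < √(4 * s * g₁ s t ^ 2 + h₁ y t ^ 2) := Real.sqrt_pos.2 hQ
  exact ⟨_, _, hasBoundaryData_rotational hn hz hsm (fun q τ _ => Iff.rfl) hp
    (fun s hs => hg₁ t htI s hs) (fun y => hh₁ t htI y) (hg₂ t htI _ hs) (hh₂ t htI _)
    (hgt t htI _ hs) (hht t htI _) rfl rfl rfl rfl hN,
    axisVec_mem (by positivity) (by positivity), hr _ hN (Real.sq_sqrt hQ0)⟩

theorem contDiff_height (c z : Space n) :
    ContDiff ℝ ∞ fun q : Space n × ℝ => (inner ℝ z (q.1 - c) : ℝ) :=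
  contDiff_const.inner ℝ (contDiff_fst.sub contDiff_const)

/-- Balls that move along an axis and shrink are supersolutions, if they do so slowly enough. -/
theorem isSupersolution_ball (hn : 1 ≤ n) {f : (Fin n → ℝ) → ℝ} (hf : IsSpeed f) {a b : ℝ}
    (c : Space n) {z : Space n} (hz : ‖z‖ = 1) {r m ν : ℝ} (hr : 0 ≤ r) (hm : 0 ≤ m)
    (hmν : m + 2 * |ν| * r ≤ 2) (hpos : ∀ t ∈ Icc a b, 0 < r ^ 2 - m * (t - a)) :
    IsSupersolution f (fun t => {p | axisDistSq c z p +
      ((inner ℝ z (p - c) - ν * (t - a)) ^ 2 - (r ^ 2 - m * (t - a))) ≤ 0}) a b := by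
  refine isSmoothEvolution_rotational hn hz (g := fun s _ => s) (g₁ := fun _ _ => 1)
    (g₂ := fun _ _ => 0) (gt := fun _ _ => 0)
    (h := fun y t => (y - ν * (t - a)) ^ 2 - (r ^ 2 - m * (t - a)))
    (h₁ := fun y t => 2 * (y - ν * (t - a))) (h₂ := fun _ _ => 2)
    (ht := fun y t => m - 2 * ν * (y - ν * (t - a))) ?_ ?_ ?_ ?_ ?_ ?_ ?_ ?_
  · have h1 := contDiff_height c z
    have h2 : ContDiff ℝ ∞ fun q : Space n × ℝ => axisDistSq c z q.1 :=
      (contDiff_axisDistSq c z).comp contDiff_fst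
    have h3 : ContDiff ℝ ∞ fun q : Space n × ℝ => q.2 := contDiff_snd
    fun_prop
  · exact fun t _ s _ => hasDerivAt_id s
  · exact fun t _ s _ => hasDerivAt_const _ _
  · exact fun t _ s _ => hasDerivAt_const _ _
  · intro t _ y
    refine ((((hasDerivAt_id y).sub_const _).pow 2).sub_const _).congr_deriv ?_
    simp
  · intro t _ y
    refine (((hasDerivAt_id y).sub_const _).const_mul 2).congr_deriv ?_
    simp
  · intro t _ y
    have h1 : HasDerivAt (fun t : ℝ => t - a) 1 t := (hasDerivAt_id t).sub_const a
    refine ((((h1.const_mul ν).const_sub y).pow 2).sub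
      ((h1.const_mul m).const_sub (r ^ 2))).congr_deriv ?_
    simp
    ring
  · intro t ht s hs y h0
    have hρ := hpos t ht
    set Y := y - ν * (t - a)
    have hsY : s + Y ^ 2 = r ^ 2 - m * (t - a) := by linarith
    refine ⟨one_pos, by nlinarith, fun N hN hN2 => ?_⟩
    -- The sphere is umbilic: both curvatures equal `2 / N`, so the claim becomes `m - 2νY ≤ 2`.
    have e : ((2 * 1 + 4 * s * 0) * (2 * Y) ^ 2 + 4 * s * 1 ^ 2 * 2) / N ^ 3 = 2 * 1 / N := by
      rw [div_eq_div_iff (by positivity) hN.ne']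
      calc _ = 2 * (4 * s * 1 ^ 2 + (2 * Y) ^ 2) * N := by ring
        _ = _ := by rw [← hN2]; ring
    rw [e, hf.apply_const (by positivity)]
    gcongr
    have hYr : |Y| ≤ r := by
      refine abs_le_of_sq_le_sq ?_ hr
      have := mul_nonneg hm (sub_nonneg.2 ht.1)
      linarith
    have h2 : -(ν * Y) ≤ |ν| * r := by
      refine (neg_le_abs _).trans ?_
      rw [abs_mul]
      gcongr
    linarith

/-- Three choices are used: `m = 2, ν = 0` (shrinking balls), `m = 0, |ν| = 1/r` (translating balls)
and `m = ν = 0` (static balls). -/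
theorem IsInnerBarrier.subset_ball (hn : 1 ≤ n) {f : (Fin n → ℝ) → ℝ} (hf : IsSpeed f)
    {A : ℝ → Set (Space n)} {T a t : ℝ} (hA : IsInnerBarrier f A (Icc 0 T)) (ha : 0 ≤ a)
    (hat : a ≤ t) (htT : t ≤ T) {c : Space n} {z : Space n} (hz : ‖z‖ = 1) {r m ν : ℝ} (hr : 0 ≤ r)
    (hm : 0 ≤ m) (hmν : m + 2 * |ν| * r ≤ 2) (hpos : 0 < r ^ 2 - m * (t - a))
    (h0 : A a ⊆ Metric.closedBall c r) :
    ∀ p ∈ A t, ‖p - (c + (ν * (t - a)) • z)‖ ^ 2 ≤ r ^ 2 - m * (t - a) := by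
  have key : ∀ (τ : ℝ) (p : Space n), ‖p - (c + (ν * τ) • z)‖ ^ 2 =
      axisDistSq c z p + (inner ℝ z (p - c) - ν * τ) ^ 2 := fun τ p => by
    rw [show p - (c + (ν * τ) • z) = (p - c) - (ν * τ) • z by abel, norm_sub_sq_real,
      ← axisDistSq_add_sq hz, inner_smul_right, norm_smul, hz, real_inner_comm, mul_one,
      Real.norm_eq_abs, sq_abs]
    ring
  have h0' : ∀ p ∈ A a, axisDistSq c z p +
      ((inner ℝ z (p - c) - ν * (a - a)) ^ 2 - (r ^ 2 - m * (a - a))) ≤ 0 := fun p hp => by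
    have h1 := mem_closedBall_iff_norm.1 (h0 hp)
    have h2 : ‖p - c‖ ^ 2 ≤ r ^ 2 := by gcongr
    have h3 := key 0 p
    simp only [mul_zero, zero_smul, add_zero] at h3
    rw [h3] at h2
    simp only [sub_self, mul_zero]
    linarith
  intro p hp
  rw [key]
  have h1 : axisDistSq c z p +
      ((inner ℝ z (p - c) - ν * (t - a)) ^ 2 - (r ^ 2 - m * (t - a))) ≤ 0 := by
    rcases hat.eq_or_lt with rfl | hat
    · exact h0' p hp
    · refine hA a t hat (Icc_subset_Icc ha htT) _ (isSupersolution_ball hn hf c hz hr hm hmν ?_) h0'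
        t ⟨hat.le, le_rfl⟩ hp
      intro τ hτ
      have := mul_le_mul_of_nonneg_left (sub_le_sub_right hτ.2 a) hm
      linarith
  linarith

theorem IsInnerBarrier.subset_closedBall (hn : 1 ≤ n) {f : (Fin n → ℝ) → ℝ} (hf : IsSpeed f)
    {A : ℝ → Set (Space n)} {T t : ℝ} (hA : IsInnerBarrier f A (Icc 0 T)) (ht : 0 ≤ t)
    (htT : t ≤ T) {c : Space n} {r : ℝ} (hr : 0 < r) (h0 : A 0 ⊆ Metric.closedBall c r) :
    A t ⊆ Metric.closedBall c r := by
  obtain ⟨z, hz⟩ := exists_norm_eq (Space n) zero_le_one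
  intro p hp
  have := hA.subset_ball hn hf le_rfl ht htT hz hr.le le_rfl (ν := 0) (by simp)
    (by simpa using pow_pos hr 2) h0 p hp
  simp only [zero_mul, zero_smul, add_zero, sub_zero] at this
  exact mem_closedBall_iff_norm.2 ((sq_le_sq₀ (norm_nonneg _) hr.le).1 this)

/-- Supporting half-spaces of the initial set contain the later ones. -/
theorem IsInnerBarrier.inner_le (hn : 1 ≤ n) {f : (Fin n → ℝ) → ℝ} (hf : IsSpeed f)
    {A : ℝ → Set (Space n)} {T t : ℝ} (hA : IsInnerBarrier f A (Icc 0 T)) (ht : 0 ≤ t)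
    (htT : t ≤ T) (hbdd : Bornology.IsBounded (A 0)) {z y₀ : Space n} (hz : ‖z‖ = 1)
    (h0 : ∀ p ∈ A 0, inner ℝ z (p - y₀) ≤ 0) : ∀ p ∈ A t, inner ℝ z (p - y₀) ≤ 0 := by
  obtain ⟨ϱ, hϱ0, hϱ⟩ := hbdd.subset_closedBall_lt 0 y₀
  have hsq : ∀ (H : ℝ) (p : Space n), ‖p - (y₀ - H • z)‖ ^ 2 =
      ‖p - y₀‖ ^ 2 + 2 * H * inner ℝ z (p - y₀) + H ^ 2 := fun H p => by
    rw [show p - (y₀ - H • z) = (p - y₀) + H • z by abel, norm_add_sq_real, inner_smul_right,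
      norm_smul, hz, real_inner_comm, mul_one, Real.norm_eq_abs, sq_abs]
    ring
  intro p hp
  by_contra! hlt
  set d : ℝ := inner ℝ z (p - y₀)
  -- A half-space has zero curvature, so a large static ball replaces it. This `H` puts `p` at
  -- squared distance at least `2ϱ² + H²` from the centre, outside the ball of squared radius `ϱ² +
  -- H²`.
  set H := ϱ ^ 2 / d with hH
  have hH0 : 0 < H := by positivity
  have hsub : A 0 ⊆ Metric.closedBall (y₀ - H • z) √(ϱ ^ 2 + H ^ 2) := fun q hq => by
    rw [mem_closedBall_iff_norm]
    refine Real.le_sqrt_of_sq_le ?_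
    rw [hsq]
    have h1 := mem_closedBall_iff_norm.1 (hϱ hq)
    have h2 : ‖q - y₀‖ ^ 2 ≤ ϱ ^ 2 := by gcongr
    have h3 := mul_nonneg hH0.le (neg_nonneg.2 (h0 q hq))
    linarith
  have h1 := mem_closedBall_iff_norm.1
    (hA.subset_closedBall hn hf ht htT (by positivity) hsub hp)
  have h2 := hsq H p
  have h3 : ‖p - (y₀ - H • z)‖ ^ 2 ≤ ϱ ^ 2 + H ^ 2 := by
    rw [← Real.sq_sqrt (show 0 ≤ ϱ ^ 2 + H ^ 2 by positivity)]; gcongr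
  have h4 : 2 * H * d = 2 * ϱ ^ 2 := by rw [hH]; field_simp
  have h5 : 2 * H * inner ℝ z (p - y₀) = 2 * ϱ ^ 2 := h4
  nlinarith [sq_nonneg ‖p - y₀‖, pow_pos hϱ0 2]

/-- Thin ellipsoids of revolution whose sections orthogonal to the axis shrink fast are
subsolutions. -/
theorem isSubsolution_ellipsoid (hn : 1 ≤ n) {f : (Fin n → ℝ) → ℝ} (hf : IsSpeed f) {K : ℝ}
    (hK : ∀ x, 0 < x → fhat f x ≤ K) {b : ℝ} (c : Space n) {z : Space n} (hz : ‖z‖ = 1) {ρ m : ℝ}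
    (hm : 0 < m) (hb : ∀ t ∈ Icc 0 b, 2 * K * t < ρ) :
    IsSubsolution f (fun t => {p | (axisDistSq c z p + 2 * K * t) +
      (m * inner ℝ z (p - c) ^ 2 - ρ) ≤ 0}) 0 b := by
  refine isSmoothEvolution_rotational hn hz (g := fun s t => s + 2 * K * t) (g₁ := fun _ _ => 1)
    (g₂ := fun _ _ => 0) (gt := fun _ _ => 2 * K) (h := fun y _ => m * y ^ 2 - ρ)
    (h₁ := fun y _ => 2 * m * y) (h₂ := fun _ _ => 2 * m) (ht := fun _ _ => 0)
    ?_ ?_ ?_ ?_ ?_ ?_ ?_ ?_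
  · have h1 := contDiff_height c z
    have h2 : ContDiff ℝ ∞ fun q : Space n × ℝ => axisDistSq c z q.1 :=
      (contDiff_axisDistSq c z).comp contDiff_fst
    have h3 : ContDiff ℝ ∞ fun q : Space n × ℝ => q.2 := contDiff_snd
    fun_prop
  · exact fun t _ s _ => (hasDerivAt_id s).add_const _
  · exact fun t _ s _ => hasDerivAt_const _ _
  · intro t _ s _
    refine (((hasDerivAt_id t).const_mul (2 * K)).const_add s).congr_deriv ?_
    simp
  · intro t _ y
    refine ((((hasDerivAt_id y).pow 2).const_mul m).sub_const _).congr_deriv ?_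
    simp
    ring
  · intro t _ y
    refine ((hasDerivAt_id y).const_mul (2 * m)).congr_deriv ?_
    simp
  · exact fun t _ y => hasDerivAt_const _ _
  · intro t ht s hs y h0
    have hρ := hb t ht
    have hsy : 0 < s + m * y ^ 2 := by linarith
    have hκ : 0 < (2 * 1 + 4 * s * 0) * (2 * m * y) ^ 2 + 4 * s * 1 ^ 2 * (2 * m) := by
      have : 0 < 8 * m * (s + m * y ^ 2) := by positivity
      linarith
    refine ⟨one_pos, hκ, fun N hN hN2 => ?_⟩
    -- The inward speed is `2K / N`, exactly `K` times the rotational curvature.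
    rw [hf.apply_axisVec (by positivity) (by positivity),
      show (2 * K + 0) / N = 2 * 1 / N * K by ring]
    gcongr
    exact hK _ (by positivity)

theorem IsBarrierSolution.mem_frontier (hn : 1 ≤ n) {f : (Fin n → ℝ) → ℝ} (hf : IsSpeed f) {K : ℝ}
    (hK1 : 1 ≤ K) (hK : ∀ x, 0 < x → fhat f x ≤ K) {T : ℝ} {Ω : ℝ → Set (Space n)}
    (hΩ : IsBarrierSolution f Ω (Icc 0 T)) (hbdd : Bornology.IsBounded (Ω 0)) {z y₀ : Space n}
    {r : ℝ} (hz : ‖z‖ = 1) (hr : 0 < r) (hle : ∀ p ∈ Ω 0, inner ℝ z (p - y₀) ≤ 0)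
    (hball : ∀ p, ‖p - y₀‖ < r → inner ℝ z (p - y₀) < 0 → p ∈ Ω 0) {t : ℝ} (ht : 0 < t)
    (htT : t ≤ T) (htr : 16 * K * t ≤ r ^ 2) : y₀ ∈ frontier (Ω t) := by
  refine ⟨?_, fun hint => ?_⟩
  · have hmem : ∀ d, 0 < d → d < r / 4 → y₀ - (2 * d) • z ∈ Ω t := fun d hd hdr => by
      set c := y₀ - (2 * d) • z with hc
      -- The initial ellipsoid has half-height `d` and sectional radius `r / 2`. Centred at depth
      -- `2d` it lies strictly below the plane, within squared distance `r²/4 + 9d² < r²` of `y₀`;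
      -- its centre survives while `2Kτ < r²/4`.
      have hm : 0 < r ^ 2 / (4 * d ^ 2) := by positivity
      have hpos : ∀ τ ∈ Icc 0 t, 2 * K * τ < r ^ 2 / 4 := fun τ hτ => by
        have : K * τ ≤ K * t := by gcongr; exact hτ.2
        nlinarith [pow_pos hr 2]
      refine hΩ.1 0 t ht (Icc_subset_Icc le_rfl htT) _
        (isSubsolution_ellipsoid hn hf hK c hz hm hpos) ?_ t ⟨ht.le, le_rfl⟩ ?_
      · intro p hp
        simp only [mem_ofPred_eq, mul_zero, add_zero] at hp
        have hs := axisDistSq_nonneg c z p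
        set y : ℝ := inner ℝ z (p - c) with hy
        have hyd : y ^ 2 ≤ d ^ 2 := by
          have h1 : r ^ 2 / (4 * d ^ 2) * y ^ 2 ≤ r ^ 2 / 4 := by linarith
          have h2 : r ^ 2 / (4 * d ^ 2) * y ^ 2 = r ^ 2 / 4 * (y ^ 2 / d ^ 2) := by
            field_simp
          rw [h2] at h1
          have h3 : y ^ 2 / d ^ 2 ≤ 1 := by
            by_contra! h4
            nlinarith [pow_pos hr 2]
          rwa [div_le_one (by positivity)] at h3
        have hy1 := abs_le_of_sq_le_sq' hyd hd.le
        have hyy : inner ℝ z (p - y₀) = y - 2 * d := by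
          rw [hy, hc, show p - (y₀ - (2 * d) • z) = (p - y₀) + (2 * d) • z by abel,
            inner_add_right, inner_smul_right, real_inner_self_eq_norm_sq, hz]
          ring
        refine hball p ?_ (by rw [hyy]; linarith [hy1.2])
        have hpc : ‖p - c‖ ^ 2 ≤ r ^ 2 / 4 + d ^ 2 := by
          rw [← axisDistSq_add_sq hz, ← hy]
          have : 0 ≤ r ^ 2 / (4 * d ^ 2) * y ^ 2 := by positivity
          linarith
        have h5 : ‖p - y₀‖ ^ 2 = ‖p - c‖ ^ 2 - 4 * d * y + 4 * d ^ 2 := by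
          rw [show p - y₀ = (p - c) - (2 * d) • z by rw [hc]; abel, norm_sub_sq_real,
            inner_smul_right, norm_smul, hz, real_inner_comm, ← hy, mul_one, Real.norm_eq_abs,
            sq_abs]
          ring
        refine lt_of_pow_lt_pow_left₀ 2 hr.le ?_
        rw [h5]
        nlinarith [hy1.1]
      · have := hpos t ⟨ht.le, le_rfl⟩
        have h0 : axisDistSq c z c = 0 := by simp [axisDistSq]
        simp only [mem_ofPred_eq, h0, sub_self, inner_zero_right]
        linarith
    have hlim : Tendsto (fun d : ℝ => y₀ - (2 * d) • z) (𝓝[>] 0) (𝓝 y₀) := by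
      have : Continuous fun d : ℝ => y₀ - (2 * d) • z := by fun_prop
      simpa using (this.tendsto 0).mono_left nhdsWithin_le_nhds
    refine mem_closure_of_tendsto hlim ?_
    filter_upwards [Ioo_mem_nhdsGT (show (0 : ℝ) < r / 4 by positivity)] with d hd
    exact hmem d hd.1 hd.2
  · have hlim : Tendsto (fun d : ℝ => y₀ + d • z) (𝓝[>] 0) (𝓝 y₀) := by
      have : Continuous fun d : ℝ => y₀ + d • z := by fun_prop
      simpa using (this.tendsto 0).mono_left nhdsWithin_le_nhds
    obtain ⟨d, hd, hd0⟩ := ((hlim.eventually (mem_interior_iff_mem_nhds.1 hint)).and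
      self_mem_nhdsWithin).exists
    have := hΩ.2.inner_le hn hf ht.le htT hbdd hz hle _ hd
    rw [add_sub_cancel_left, inner_smul_right, real_inner_self_eq_norm_sq, hz] at this
    have hd0 : 0 < d := hd0
    linarith

/-- The sets of an inner barrier are empty once the enclosing shrinking spheres have vanished. -/
theorem IsInnerBarrier.two_mul_le_sq (hn : 1 ≤ n) {f : (Fin n → ℝ) → ℝ} (hf : IsSpeed f)
    {A : ℝ → Set (Space n)} {T t : ℝ} (hA : IsInnerBarrier f A (Icc 0 T))
    (htT : t ≤ T) (hne : (A t).Nonempty) {c : Space n} {R : ℝ} (hR : 0 < R)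
    (h0 : A 0 ⊆ Metric.closedBall c R) : 2 * t ≤ R ^ 2 := by
  by_contra! hlt
  obtain ⟨z, hz⟩ := exists_norm_eq (Space n) zero_le_one
  set δ := t - R ^ 2 / 2 with hδ
  have hδ0 : 0 < δ := by linarith
  -- Shrinking spheres are valid only before extinction, so they are stopped at radius `ε` at time
  -- `s`. The choice `ε² < δ ≤ t - s` leaves enough time for what follows.
  set ε := min (R / 2) (√δ / 2) with hε
  have hε0 : 0 < ε := by positivity
  have hεR : ε < R := (min_le_left _ _).trans_lt (by linarith)
  have hεδ : ε ^ 2 < δ := by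
    have h1 : ε ≤ √δ / 2 := min_le_right _ _
    have h2 : ε ^ 2 ≤ (√δ / 2) ^ 2 := by gcongr
    rw [div_pow, Real.sq_sqrt hδ0.le] at h2
    linarith
  set s := (R ^ 2 - ε ^ 2) / 2 with hs
  have hs0 : 0 ≤ s := by nlinarith
  have hst : s + δ ≤ t := by nlinarith [sq_nonneg ε]
  have h1 : A s ⊆ Metric.closedBall c ε := fun p hp => by
    have := hA.subset_ball hn hf le_rfl hs0 (by linarith) hz hR.le zero_le_two (ν := 0) (by simp)
      (by rw [hs, sub_zero]; nlinarith [pow_pos hε0 2]) h0 p hp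
    simp only [zero_mul, zero_smul, add_zero, sub_zero] at this
    refine mem_closedBall_iff_norm.2 ((sq_le_sq₀ (norm_nonneg _) hε0.le).1 ?_)
    rw [hs] at this
    linarith
  obtain ⟨p, hp⟩ := hne
  -- A ball of radius `ε` may translate at speed `1/ε` in either direction. The set lies in both
  -- translates, which are disjoint once `t - s > ε²`.
  have h2 : ∀ ν : ℝ, |ν| = ε⁻¹ → ‖p - (c + (ν * (t - s)) • z)‖ ≤ ε := fun ν hν => by
    have := hA.subset_ball hn hf hs0 (by linarith) htT hz hε0.le le_rfl (ν := ν)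
      (by rw [hν, zero_add, mul_assoc, inv_mul_cancel₀ hε0.ne', mul_one])
      (by simpa using pow_pos hε0 2) h1 p hp
    rw [zero_mul, sub_zero] at this
    exact (sq_le_sq₀ (norm_nonneg _) hε0.le).1 this
  have h3 := h2 ε⁻¹ (abs_of_pos (by positivity))
  have h4 := h2 (-ε⁻¹) (by rw [abs_neg, abs_of_pos (by positivity)])
  have h5 : ‖(2 * (ε⁻¹ * (t - s))) • z‖ ≤ ε + ε := by
    calc _ = ‖(p - (c + (-ε⁻¹ * (t - s)) • z)) - (p - (c + (ε⁻¹ * (t - s)) • z))‖ := by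
          congr 1
          module
      _ ≤ _ := (norm_sub_le _ _).trans (add_le_add h4 h3)
  have hts : 0 < t - s := by linarith
  rw [norm_smul, hz, mul_one, Real.norm_of_nonneg (by positivity)] at h5
  have h6 : ε⁻¹ * (t - s) ≤ ε := by linarith
  rw [inv_mul_le_iff₀ hε0] at h6
  nlinarith

end CurvatureFlow

/-! ### The exponential profile and the graph barrier. -/

namespace CurvatureFlow

variable {n : ℕ}

/-- The profile `exp √(1 + l² s)` as a function of the squared distance `s` from the axis. -/
noncomputable def profile (l s : ℝ) : ℝ := Real.exp √(1 + l ^ 2 * s)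

/-- The first derivative of `profile l`. -/
noncomputable def profileDeriv (l s : ℝ) : ℝ := profile l s * l ^ 2 / (2 * √(1 + l ^ 2 * s))

/-- The second derivative of `profile l`. -/
noncomputable def profileDeriv₂ (l s : ℝ) : ℝ :=
  profile l s * l ^ 4 / 4 * (1 / √(1 + l ^ 2 * s) ^ 2 - 1 / √(1 + l ^ 2 * s) ^ 3)

theorem one_le_sqrt {l s : ℝ} (hs : 0 ≤ s) : 1 ≤ √(1 + l ^ 2 * s) := by
  rw [Real.one_le_sqrt]
  have : 0 ≤ l ^ 2 * s := by positivity
  linarith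

theorem profile_pos (l s : ℝ) : 0 < profile l s := Real.exp_pos _

theorem profileDeriv_pos {l s : ℝ} (hl : 0 < l) (hs : 0 ≤ s) : 0 < profileDeriv l s := by
  have := profile_pos l s
  have := one_le_sqrt (l := l) hs
  unfold profileDeriv
  positivity

theorem hasDerivAt_sqrt_profile (l : ℝ) {s : ℝ} (hs : 0 ≤ s) :
    HasDerivAt (fun s => √(1 + l ^ 2 * s)) (l ^ 2 / (2 * √(1 + l ^ 2 * s))) s := by
  have h1 : HasDerivAt (fun s => 1 + l ^ 2 * s) (l ^ 2) s := by
    simpa using ((hasDerivAt_id s).const_mul (l ^ 2)).const_add 1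
  exact h1.sqrt (by positivity)

theorem hasDerivAt_profile (l : ℝ) {s : ℝ} (hs : 0 ≤ s) :
    HasDerivAt (profile l) (profileDeriv l s) s := by
  refine (hasDerivAt_sqrt_profile l hs).exp.congr_deriv ?_
  unfold profileDeriv profile
  ring

theorem hasDerivAt_profileDeriv (l : ℝ) {s : ℝ} (hs : 0 ≤ s) :
    HasDerivAt (profileDeriv l) (profileDeriv₂ l s) s := by
  have h1 := one_le_sqrt (l := l) hs
  refine (((hasDerivAt_profile l hs).mul_const (l ^ 2)).div
    ((hasDerivAt_sqrt_profile l hs).const_mul 2) (by positivity)).congr_deriv ?_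
  unfold profileDeriv₂ profileDeriv
  field_simp
  ring

/-- The left side is the second derivative of the profile in the distance `√s`, the numerator of the
meridian curvature of the graph. -/
theorem two_mul_profileDeriv_add (l : ℝ) {s : ℝ} (hs : 0 ≤ s) :
    2 * profileDeriv l s + 4 * s * profileDeriv₂ l s =
      profile l s * l ^ 2 * (1 - (√(1 + l ^ 2 * s))⁻¹ ^ 2 + (√(1 + l ^ 2 * s))⁻¹ ^ 3) := by
  have h1 := one_le_sqrt (l := l) hs
  have h2 : √(1 + l ^ 2 * s) ^ 2 = 1 + l ^ 2 * s := Real.sq_sqrt (by positivity)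
  have h3 : l ^ 4 * s = l ^ 2 * (√(1 + l ^ 2 * s) ^ 2 - 1) := by rw [h2]; ring
  unfold profileDeriv₂ profileDeriv
  set v := √(1 + l ^ 2 * s)
  calc _ = profile l s * (l ^ 2 / v + l ^ 4 * s * (1 / v ^ 2 - 1 / v ^ 3)) := by
        field_simp
    _ = _ := by
        rw [h3]
        field_simp
        ring

/-- The minimum is at `u = 2/3`; the difference factors as `(u - 2/3)² (u + 1/3)`. -/
theorem le_one_sub_sq_add_cube {u : ℝ} (hu : 0 ≤ u) : 23 / 27 ≤ 1 - u ^ 2 + u ^ 3 := by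
  have : 0 ≤ (u - 2 / 3) ^ 2 * (u + 1 / 3) := by positivity
  linarith

theorem two_mul_profileDeriv_add_pos {l s : ℝ} (hl : 0 < l) (hs : 0 ≤ s) :
    0 < 2 * profileDeriv l s + 4 * s * profileDeriv₂ l s := by
  rw [two_mul_profileDeriv_add l hs]
  have h1 := le_one_sub_sq_add_cube (inv_nonneg.2 (Real.sqrt_nonneg (1 + l ^ 2 * s)))
  have := profile_pos l s
  exact mul_pos (by positivity) (by linarith)

theorem continuousAt_profileDeriv₂ (l : ℝ) {s : ℝ} (hs : 0 ≤ s) :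
    ContinuousAt (profileDeriv₂ l) s := by
  have h4 : √(1 + l ^ 2 * s) ≠ 0 := (zero_lt_one.trans_le (one_le_sqrt hs)).ne'
  have h2 := (hasDerivAt_sqrt_profile l hs).continuousAt
  have h3 := (hasDerivAt_profile l hs).continuousAt
  unfold profileDeriv₂
  exact ((h3.mul continuousAt_const).div_const _).mul
    ((continuousAt_const.div (h2.pow 2) (pow_ne_zero _ h4)).sub
      (continuousAt_const.div (h2.pow 3) (pow_ne_zero _ h4)))

theorem exists_cutoff {A B : ℝ} (h : A < B) : ∃ η : ℝ → ℝ, ContDiff ℝ ∞ η ∧ (∀ s, η s ≤ 1) ∧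
    (∀ s ≤ A, η s = 1) ∧ ∀ s, B ≤ s → η s = 0 := by
  have hBA : 0 < B - A := sub_pos.2 h
  refine ⟨fun s => Real.smoothTransition ((B - s) / (B - A)), ?_,
    fun s => Real.smoothTransition.le_one _,
    fun s hs => Real.smoothTransition.one_of_one_le ?_,
    fun s hs => Real.smoothTransition.zero_of_nonpos ?_⟩
  · exact Real.smoothTransition.contDiff.comp ((contDiff_const.sub contDiff_id).div_const _)
  · rw [one_le_div hBA]; linarith
  · exact div_nonpos_of_nonpos_of_nonneg (by linarith) hBA.le

/-- The conditions under which small multiples of a cutoff of the profile may be added to it over a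
compact range of `s`, so that the graph remains a strict supersolution there. -/
theorem exists_perturbation {l χ F μ M B : ℝ} {η : ℝ → ℝ} (hl : 0 < l) (hη : ContDiff ℝ ∞ η)
    (h1 : ∀ s ∈ Icc 0 B, 2 * profileDeriv l s + 4 * s * profileDeriv₂ l s <
      χ * (2 * profileDeriv l s))
    (h2 : ∀ s ∈ Icc 0 B, 4 * s * (M * profileDeriv l s) ^ 2 < 1 / 4)
    (h3 : ∀ s ∈ Icc 0 B, μ * profile l s * (5 / 4) * χ <
      F * (2 * profileDeriv l s + 4 * s * profileDeriv₂ l s)) :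
    ∃ ε₀, 0 < ε₀ ∧ ∀ ε ∈ Icc 0 ε₀, ∀ s ∈ Icc 0 B, ∀ W₁ W₂ : ℝ,
      W₁ = ε * (deriv η s * profile l s) + (1 + ε * η s) * profileDeriv l s →
      W₂ = ε * (deriv (deriv η) s * profile l s + 2 * (deriv η s * profileDeriv l s)) +
        (1 + ε * η s) * profileDeriv₂ l s →
      0 < W₁ ∧ 0 < 2 * W₁ + 4 * s * W₂ ∧ 2 * W₁ + 4 * s * W₂ < χ * (2 * W₁) ∧
      4 * s * (M * W₁) ^ 2 < 1 / 4 ∧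
      μ * (1 + ε) * profile l s * (5 / 4) * χ < F * (2 * W₁ + 4 * s * W₂) := by
  have key : ∀ᶠ ε in 𝓝 (0 : ℝ), ∀ s ∈ Icc 0 B, ∀ W₁ W₂ : ℝ,
      W₁ = ε * (deriv η s * profile l s) + (1 + ε * η s) * profileDeriv l s →
      W₂ = ε * (deriv (deriv η) s * profile l s + 2 * (deriv η s * profileDeriv l s)) +
        (1 + ε * η s) * profileDeriv₂ l s →
      0 < W₁ ∧ 0 < 2 * W₁ + 4 * s * W₂ ∧ 2 * W₁ + 4 * s * W₂ < χ * (2 * W₁) ∧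
      4 * s * (M * W₁) ^ 2 < 1 / 4 ∧
      μ * (1 + ε) * profile l s * (5 / 4) * χ < F * (2 * W₁ + 4 * s * W₂) := by
    -- At `ε = 0` these are strict inequalities between functions continuous in `(ε, s)`, so
    -- compactness of `[0, B]` gives a uniform `ε₀`.
    refine isCompact_Icc.eventually_forall_of_forall_eventually fun s hs => ?_
    have d1 : Continuous (deriv η) := hη.continuous_deriv (by simp)
    have d2 : Continuous (deriv (deriv η)) :=
      (contDiff_infty_iff_deriv.1 hη).2.continuous_deriv (by simp)
    have c0 : ContinuousAt (fun q : ℝ × ℝ => profile l q.2) (0, s) :=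
      ContinuousAt.comp (g := profile l) (f := Prod.snd) (x := ((0 : ℝ), s)) (hasDerivAt_profile l hs.1).continuousAt continuousAt_snd
    have c1 : ContinuousAt (fun q : ℝ × ℝ => profileDeriv l q.2) (0, s) :=
      ContinuousAt.comp (g := profileDeriv l) (f := Prod.snd) (x := ((0 : ℝ), s)) (hasDerivAt_profileDeriv l hs.1).continuousAt
        continuousAt_snd
    have c2 : ContinuousAt (fun q : ℝ × ℝ => profileDeriv₂ l q.2) (0, s) :=
      ContinuousAt.comp (g := profileDeriv₂ l) (f := Prod.snd) (x := ((0 : ℝ), s)) (continuousAt_profileDeriv₂ l hs.1) continuousAt_snd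
    have e0 : ContinuousAt (fun q : ℝ × ℝ => η q.2) (0, s) :=
      (hη.continuous.comp continuous_snd).continuousAt
    have e1 : ContinuousAt (fun q : ℝ × ℝ => deriv η q.2) (0, s) :=
      (d1.comp continuous_snd).continuousAt
    have e2 : ContinuousAt (fun q : ℝ × ℝ => deriv (deriv η) q.2) (0, s) :=
      (d2.comp continuous_snd).continuousAt
    have f1 : ContinuousAt (fun q : ℝ × ℝ => q.1) (0, s) := continuousAt_fst
    have f2 : ContinuousAt (fun q : ℝ × ℝ => q.2) (0, s) := continuousAt_snd
    have w1 : ContinuousAt (fun q : ℝ × ℝ => q.1 * (deriv η q.2 * profile l q.2) +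
        (1 + q.1 * η q.2) * profileDeriv l q.2) (0, s) :=
      (f1.mul (e1.mul c0)).add (((f1.mul e0).const_add 1).mul c1)
    have w2 : ContinuousAt (fun q : ℝ × ℝ =>
        q.1 * (deriv (deriv η) q.2 * profile l q.2 + 2 * (deriv η q.2 * profileDeriv l q.2)) +
        (1 + q.1 * η q.2) * profileDeriv₂ l q.2) (0, s) :=
      (f1.mul ((e2.mul c0).add ((e1.mul c1).const_mul 2))).add
        (((f1.mul e0).const_add 1).mul c2)
    have g1 : ∀ᶠ q : ℝ × ℝ in 𝓝 (0, s), 0 < q.1 * (deriv η q.2 * profile l q.2) +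
        (1 + q.1 * η q.2) * profileDeriv l q.2 :=
      continuousAt_const.eventually_lt w1 (by simpa using profileDeriv_pos hl hs.1)
    have wl := (w1.const_mul 2).add ((f2.const_mul 4).mul w2)
    have g2 := (continuousAt_const (y := (0 : ℝ))).eventually_lt wl
      (by simpa using two_mul_profileDeriv_add_pos hl hs.1)
    have g3 := wl.eventually_lt ((w1.const_mul 2).const_mul χ) (by simpa using h1 s hs)
    have g4 := ((f2.const_mul 4).mul ((w1.const_mul M).pow 2)).eventually_lt
      (continuousAt_const (y := (1 / 4 : ℝ))) (by simpa using h2 s hs)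
    have g5 := ((((f1.const_add 1).const_mul μ).mul c0).mul_const (5 / 4)).mul_const χ
      |>.eventually_lt (wl.const_mul F) (by simpa using h3 s hs)
    filter_upwards [g1, g2, g3, g4, g5] with q q1 q2 q3 q4 q5 W₁ W₂ e₁ e₂
    subst e₁ e₂
    exact ⟨q1, q2, q3, q4, q5⟩
  obtain ⟨ε₀, hε₀, h⟩ := Metric.eventually_nhds_iff_ball.1 key
  refine ⟨ε₀ / 2, by positivity, fun ε hε => h ε ?_⟩
  rw [Metric.mem_ball, Real.dist_eq, sub_zero, abs_of_nonneg hε.1]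
  linarith [hε.2]

/-- The moving graph used as a supersolution over a short time interval: it moves only where the
cutoff `η` does not vanish. -/
theorem isSupersolution_graph (hn : 1 ≤ n) {f : (Fin n → ℝ) → ℝ} (hf : IsSpeed f) {c z : Space n}
    (hz : ‖z‖ = 1) {l χ μ M B k a t₀ t₁ : ℝ} {η : ℝ → ℝ} (hl : 0 < l) (hχ : 0 < χ) (hμ : 0 < μ)
    (ha : 0 < a) (haM : a ≤ M) (hη : ContDiff ℝ ∞ η) (hη1 : ∀ s, η s ≤ 1)
    (hηB : ∀ s, B ≤ s → η s = 0)
    (hW : ∀ t ∈ Icc t₀ t₁, ∀ s ∈ Icc 0 B, ∀ ε W₁ W₂ : ℝ, ε = Real.exp (μ * (t - t₀)) - 1 →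
      W₁ = ε * (deriv η s * profile l s) + (1 + ε * η s) * profileDeriv l s →
      W₂ = ε * (deriv (deriv η) s * profile l s + 2 * (deriv η s * profileDeriv l s)) +
        (1 + ε * η s) * profileDeriv₂ l s →
      0 < W₁ ∧ 0 < 2 * W₁ + 4 * s * W₂ ∧ 2 * W₁ + 4 * s * W₂ < χ * (2 * W₁) ∧
      4 * s * (M * W₁) ^ 2 < 1 / 4 ∧
      μ * (1 + ε) * profile l s * (5 / 4) * χ < fhat f χ * (2 * W₁ + 4 * s * W₂)) :
    IsSupersolution f (fun t => {p | (a * ((1 + (Real.exp (μ * (t - t₀)) - 1) *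
      η (axisDistSq c z p)) * profile l (axisDistSq c z p)) - k) +
      inner ℝ z (p - c) ≤ 0}) t₀ t₁ := by
  refine isSmoothEvolution_rotational hn hz
    (g := fun s t => a * ((1 + (Real.exp (μ * (t - t₀)) - 1) * η s) * profile l s) - k)
    (g₁ := fun s t => a * ((Real.exp (μ * (t - t₀)) - 1) * (deriv η s * profile l s) +
      (1 + (Real.exp (μ * (t - t₀)) - 1) * η s) * profileDeriv l s))
    (g₂ := fun s t => a * ((Real.exp (μ * (t - t₀)) - 1) *
      (deriv (deriv η) s * profile l s + 2 * (deriv η s * profileDeriv l s)) +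
      (1 + (Real.exp (μ * (t - t₀)) - 1) * η s) * profileDeriv₂ l s))
    (gt := fun s t => a * (μ * Real.exp (μ * (t - t₀)) * η s * profile l s))
    (h := fun y _ => y) (h₁ := fun _ _ => 1) (h₂ := fun _ _ => 0) (ht := fun _ _ => 0)
    ?_ ?_ ?_ ?_ ?_ ?_ ?_ ?_
  · have h1 := contDiff_height c z
    have h2 : ContDiff ℝ ∞ fun q : Space n × ℝ => axisDistSq c z q.1 :=
      (contDiff_axisDistSq c z).comp contDiff_fst
    have h3 : ContDiff ℝ ∞ fun q : Space n × ℝ => q.2 := contDiff_snd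
    have h4 : ContDiff ℝ ∞ fun q : Space n × ℝ => η (axisDistSq c z q.1) := hη.comp h2
    have h5 : ContDiff ℝ ∞ fun q : Space n × ℝ => profile l (axisDistSq c z q.1) := by
      unfold profile
      refine ((contDiff_const.add (contDiff_const.mul h2)).sqrt fun q => ?_).exp
      have := axisDistSq_nonneg c z q.1
      positivity
    exact ((contDiff_const.mul ((contDiff_const.add
      (((contDiff_const.mul (h3.sub contDiff_const)).exp.sub contDiff_const).mul h4)).mul
        h5)).sub contDiff_const).add h1
  · intro t _ s hs
    have e1 := (hη.differentiable (by simp) s).hasDerivAt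
    refine ((((e1.const_mul _).const_add 1).mul (hasDerivAt_profile l hs)).const_mul a
      |>.sub_const k).congr_deriv ?_
    ring
  · intro t _ s hs
    have e1 := (hη.differentiable (by simp) s).hasDerivAt
    have e2 : HasDerivAt (deriv η) (deriv (deriv η) s) s :=
      ((contDiff_infty_iff_deriv.1 hη).2.differentiable (by simp) s).hasDerivAt
    refine ((((e2.mul (hasDerivAt_profile l hs)).const_mul _).add
      (((e1.const_mul _).const_add 1).mul (hasDerivAt_profileDeriv l hs))).const_mul
        a).congr_deriv ?_
    ring
  · intro t _ s _
    have e1 : HasDerivAt (fun t : ℝ => μ * (t - t₀)) μ t := by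
      simpa using ((hasDerivAt_id t).sub_const t₀).const_mul μ
    refine (((((e1.exp.sub_const 1).mul_const (η s)).const_add 1).mul_const
      (profile l s)).const_mul a |>.sub_const k).congr_deriv ?_
    ring
  · exact fun t _ y => hasDerivAt_id y
  · exact fun t _ y => hasDerivAt_const _ _
  · exact fun t _ y => hasDerivAt_const _ _
  · intro t ht s hs y _
    have hw := profile_pos l s
    have hE := Real.exp_pos (μ * (t - t₀))
    obtain ⟨W₁, hW₁⟩ : ∃ W₁, W₁ = (Real.exp (μ * (t - t₀)) - 1) * (deriv η s * profile l s) +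
      (1 + (Real.exp (μ * (t - t₀)) - 1) * η s) * profileDeriv l s := ⟨_, rfl⟩
    obtain ⟨W₂, hW₂⟩ : ∃ W₂, W₂ = (Real.exp (μ * (t - t₀)) - 1) *
      (deriv (deriv η) s * profile l s + 2 * (deriv η s * profileDeriv l s)) +
      (1 + (Real.exp (μ * (t - t₀)) - 1) * η s) * profileDeriv₂ l s := ⟨_, rfl⟩
    simp only [← hW₁, ← hW₂]
    have eL : (2 * (a * W₁) + 4 * s * (a * W₂)) * 1 ^ 2 + 4 * s * (a * W₁) ^ 2 * 0 =
        a * (2 * W₁ + 4 * s * W₂) := by ring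
    rw [eL]
    rcases le_or_gt s B with hsB | hsB
    · obtain ⟨i1, i2, i3, i4, i5⟩ := hW t ht s ⟨hs, hsB⟩ _ W₁ W₂ rfl hW₁ hW₂
      refine ⟨by positivity, by positivity, fun N hN hN2 => ?_⟩
      set Q := 2 * W₁ + 4 * s * W₂
      have hN1 : 1 ≤ N ^ 2 := by
        rw [hN2]
        have : 0 ≤ 4 * s * (a * W₁) ^ 2 := by positivity
        linarith
      have hN54 : N ^ 2 ≤ 5 / 4 := by
        have : 4 * s * (a * W₁) ^ 2 ≤ 4 * s * (M * W₁) ^ 2 := by gcongr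
        linarith
      -- `N² ≥ 1` only helps: the meridian curvature carries `N³` and the rotational one `N`.
      have hratio : a * Q / N ^ 3 ≤ χ * (2 * (a * W₁) / N) := by
        rw [div_le_iff₀ (by positivity)]
        calc a * Q ≤ a * (χ * (2 * W₁)) * 1 := by
              rw [mul_one]; gcongr
          _ ≤ a * (χ * (2 * W₁)) * N ^ 2 := by gcongr
          _ = _ := by field_simp
      refine le_trans ?_ (hf.le_apply_axisVec (by positivity) hχ hratio)
      rw [add_zero, div_le_iff₀ hN]
      have h1 : μ * Real.exp (μ * (t - t₀)) * η s * profile l s ≤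
          μ * Real.exp (μ * (t - t₀)) * 1 * profile l s := by gcongr; exact hη1 s
      have h2 : μ * Real.exp (μ * (t - t₀)) * profile l s * N ^ 2 * χ ≤ fhat f χ * Q := by
        refine le_trans ?_ i5.le
        rw [add_sub_cancel]
        gcongr
      have h3 : a * Q / N ^ 3 * fhat f χ / χ * N = a * (fhat f χ * Q / (N ^ 2 * χ)) := by
        field_simp
      rw [h3]
      gcongr
      rw [le_div_iff₀ (by positivity)]
      calc _ ≤ μ * Real.exp (μ * (t - t₀)) * 1 * profile l s * (N ^ 2 * χ) := by gcongr
        _ = μ * Real.exp (μ * (t - t₀)) * profile l s * N ^ 2 * χ := by ring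
        _ ≤ _ := h2
    -- Beyond the cutoff the graph is static and strictly convex, so its zero speed is below `f(κ)`.
    · have z0 : η =ᶠ[𝓝 s] fun _ => 0 := by
        filter_upwards [lt_mem_nhds hsB] with u hu using hηB u hu.le
      have z1 : deriv η =ᶠ[𝓝 s] fun _ => 0 := by
        simpa using z0.deriv
      have z2 : deriv (deriv η) s = 0 := by simpa using z1.deriv.eq_of_nhds
      rw [z1.eq_of_nhds, z0.eq_of_nhds] at hW₁
      rw [z1.eq_of_nhds, z0.eq_of_nhds, z2] at hW₂
      have hW₁' : W₁ = profileDeriv l s := by rw [hW₁]; ring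
      have hW₂' : W₂ = profileDeriv₂ l s := by rw [hW₂]; ring
      have p1 := profileDeriv_pos hl hs
      have p2 := two_mul_profileDeriv_add_pos hl hs
      rw [hW₁', hW₂', z0.eq_of_nhds]
      refine ⟨by positivity, by positivity, fun N hN _ => ?_⟩
      simp only [mul_zero, zero_mul, add_zero, zero_div]
      exact (hf.pos _ (axisVec_mem (by positivity) (by positivity))).le

/-- The graph `{y + a e^{μ t} w(s) ≤ k}` is an inner barrier as long as the evolving sets stay in
a cylinder over which it is a strict supersolution. -/
theorem IsInnerBarrier.subset_graph (hn : 1 ≤ n) {f : (Fin n → ℝ) → ℝ} (hf : IsSpeed f)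
    {A : ℝ → Set (Space n)} {T t : ℝ} (hA : IsInnerBarrier f A (Icc 0 T)) (ht : 0 < t)
    (htT : t ≤ T) {c z : Space n} (hz : ‖z‖ = 1) {l χ μ a k B₁ B : ℝ} (hl : 0 < l) (hχ : 0 < χ)
    (hμ : 0 < μ) (ha : 0 < a) (hB : B₁ < B)
    (hcyl : ∀ τ ∈ Icc 0 t, ∀ p ∈ A τ, axisDistSq c z p ≤ B₁)
    (h1 : ∀ s ∈ Icc 0 B, 2 * profileDeriv l s + 4 * s * profileDeriv₂ l s <
      χ * (2 * profileDeriv l s))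
    (h2 : ∀ s ∈ Icc 0 B, 4 * s * (a * Real.exp (μ * t) * profileDeriv l s) ^ 2 < 1 / 4)
    (h3 : ∀ s ∈ Icc 0 B, μ * profile l s * (5 / 4) * χ <
      fhat f χ * (2 * profileDeriv l s + 4 * s * profileDeriv₂ l s))
    (h0 : ∀ p ∈ A 0, a * profile l (axisDistSq c z p) - k + inner ℝ z (p - c) ≤ 0) :
    ∀ p ∈ A t,
      a * Real.exp (μ * t) * profile l (axisDistSq c z p) - k + inner ℝ z (p - c) ≤ 0 := by
  obtain ⟨η, hη, hη1, hηA, hηB⟩ := exists_cutoff hB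
  obtain ⟨ε₀, hε₀, hε⟩ := exists_perturbation hl hη h1 h2 h3
  -- Each step restarts from the uncut graph of amplitude `a e^{μt₀}`. The conditions scale with the
  -- amplitude except the slope bound, which is imposed at the final value `a e^{μt}`; hence one
  -- `ε₀` serves all steps.
  have step : ∀ t₀ t₁, 0 ≤ t₀ → t₀ < t₁ → t₁ ≤ t → Real.exp (μ * (t₁ - t₀)) - 1 ≤ ε₀ →
      (∀ p ∈ A t₀,
        a * Real.exp (μ * t₀) * profile l (axisDistSq c z p) - k + inner ℝ z (p - c) ≤ 0) →
      ∀ p ∈ A t₁,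
        a * Real.exp (μ * t₁) * profile l (axisDistSq c z p) - k + inner ℝ z (p - c) ≤ 0 := by
    intro t₀ t₁ ht₀ h01 h1t hle hin p hp
    have hsup : IsSupersolution f (fun τ => {p | (a * Real.exp (μ * t₀) *
        ((1 + (Real.exp (μ * (τ - t₀)) - 1) * η (axisDistSq c z p)) *
          profile l (axisDistSq c z p)) - k) + inner ℝ z (p - c) ≤ 0}) t₀ t₁ := by
      refine isSupersolution_graph hn hf hz hl hχ hμ (M := a * Real.exp (μ * t)) (by positivity)
        (by gcongr; linarith) hη hη1 hηB ?_
      intro τ hτ s hs ε W₁ W₂ e₀ e₁ e₂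
      refine hε ε ⟨?_, ?_⟩ s hs W₁ W₂ e₁ e₂
      · rw [e₀, sub_nonneg, Real.one_le_exp_iff]
        exact mul_nonneg hμ.le (sub_nonneg.2 hτ.1)
      · rw [e₀]
        refine le_trans ?_ hle
        gcongr
        exact hτ.2
    have h4 := hA t₀ t₁ h01 (Icc_subset_Icc ht₀ (h1t.trans htT)) _ hsup
      (fun q hq => by
        simpa only [mem_ofPred_eq, sub_self, mul_zero, Real.exp_zero, zero_mul, add_zero,
          one_mul] using hin q hq) t₁ ⟨h01.le, le_rfl⟩ hp
    -- The evolving set lies where `η = 1`, so the cut graph bounds it as the full graph of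
    -- amplitude `a e^{μt₁}` would.
    have h5 := hηA _ (hcyl t₁ ⟨ht₀.trans h01.le, h1t⟩ p hp)
    simp only [mem_ofPred_eq, h5, mul_one, add_sub_cancel] at h4
    have h6 : a * Real.exp (μ * t₁) =
        a * Real.exp (μ * t₀) * Real.exp (μ * (t₁ - t₀)) := by
      rw [mul_assoc, ← Real.exp_add]
      congr 2
      ring
    rw [h6]
    linarith
  obtain ⟨m, hm⟩ := exists_nat_gt (μ * t / Real.log (1 + ε₀))
  have hlog : 0 < Real.log (1 + ε₀) := Real.log_pos (by linarith)
  have hm0 : (0 : ℝ) < m := lt_trans (by positivity) hm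
  have hsmall : Real.exp (μ * (t / m)) - 1 ≤ ε₀ := by
    rw [div_lt_iff₀ hlog] at hm
    have : μ * (t / m) ≤ Real.log (1 + ε₀) := by
      rw [← mul_div_assoc, div_le_iff₀ hm0]
      linarith
    have := (Real.le_log_iff_exp_le (by linarith)).1 this
    linarith
  have hind : ∀ j : ℕ, j ≤ m → ∀ p ∈ A (j * (t / m)),
      a * Real.exp (μ * (j * (t / m))) * profile l (axisDistSq c z p) - k +
        inner ℝ z (p - c) ≤ 0 := by
    intro j
    induction j with
    | zero => simpa using h0
    | succ j ih =>
      intro hj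
      have hd : 0 < t / m := by positivity
      refine step (j * (t / m)) _ (by positivity) ?_ ?_ ?_ (ih (by omega))
      · push_cast; linarith
      · have : ((j + 1 : ℕ) : ℝ) ≤ m := by exact_mod_cast hj
        calc _ ≤ m * (t / m) := by gcongr
          _ = t := by field_simp
      · rwa [show ((j + 1 : ℕ) : ℝ) * (t / m) - j * (t / m) = t / m by push_cast; ring]
  have := hind m le_rfl
  rwa [mul_div_cancel₀ t hm0.ne'] at this

end CurvatureFlow

/-! ### Displacement of flat sides and the support function. -/

namespace CurvatureFlow

variable {n : ℕ}

theorem three_rpow_neg_le {χ : ℝ} (hχ : 0 < χ) :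
    (3 : ℝ) ^ (-χ) ≤ Real.exp (-(χ / 2)) / χ := by
  have h3 : Real.exp 1 ≤ 3 := by linarith [Real.exp_one_lt_d9]
  have h1 : Real.exp χ ≤ 3 ^ χ := by
    calc Real.exp χ = Real.exp 1 ^ χ := by rw [← Real.exp_mul, one_mul]
      _ ≤ 3 ^ χ := Real.rpow_le_rpow (Real.exp_pos _).le h3 hχ.le
  have h2 : χ ≤ Real.exp (χ / 2) := by
    have := Real.quadratic_le_exp_of_nonneg (show 0 ≤ χ / 2 by positivity)
    nlinarith [sq_nonneg (χ / 2 - 1)]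
  rw [Real.rpow_neg (by norm_num), le_div_iff₀ hχ]
  calc (3 ^ χ)⁻¹ * χ ≤ (Real.exp χ)⁻¹ * Real.exp (χ / 2) := by gcongr
    _ = _ := by rw [← Real.exp_neg, ← Real.exp_add]; congr 1; ring

/-- The lower bound for the displacement of a flat side: if the set starts in the half-space
`⟨z, p - c⟩ ≤ 0` and stays close to the cylinder of radius `R`, then at time `t` it has moved away
from the boundary of the half-space. -/
theorem IsInnerBarrier.inner_le_neg (hn : 1 ≤ n) {f : (Fin n → ℝ) → ℝ} (hf : IsSpeed f)
    {A : ℝ → Set (Space n)} {T t : ℝ} (hA : IsInnerBarrier f A (Icc 0 T)) (ht : 0 < t)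
    (htT : t ≤ T) {c z : Space n} (hz : ‖z‖ = 1) {R χ : ℝ} (hR : 0 < R) (hχ : 6 ≤ χ)
    (hfχ : fhat f χ = 3 * R ^ 2 / t)
    (hcyl : ∀ τ ∈ Icc 0 t, ∀ p ∈ A τ, axisDistSq c z p ≤ (R * (1 + 1 / (20 * χ))) ^ 2)
    (h0 : ∀ p ∈ A 0, inner ℝ z (p - c) ≤ 0) :
    ∀ p ∈ A t, inner ℝ z (p - c) ≤ -(R * 3 ^ (-χ)) := by
  have hχ0 : 0 < χ := by linarith
  set l := χ / (2 * R) with hl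
  have hl0 : 0 < l := by positivity
  set B := (R * (1 + 1 / (10 * χ))) ^ 2 with hB
  have hBB : (R * (1 + 1 / (20 * χ))) ^ 2 < B := by
    rw [hB]
    gcongr
    norm_num
  -- With `l = χ / (2R)`, `V` bounds `√(1 + l²s)` on the cylinder; this uses that `χ` is not small.
  set V := χ / 2 + 1 / 4 with hV
  have hv : ∀ s, s ≤ B → √(1 + l ^ 2 * s) ≤ V := fun s hs => by
    refine Real.sqrt_le_iff.2 ⟨by positivity, ?_⟩
    have h1 : l ^ 2 * s ≤ l ^ 2 * B := by gcongr
    have h2 : l ^ 2 * B = (χ / 2 + 1 / 20) ^ 2 := by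
      rw [hl, hB]
      field_simp
      ring
    rw [h2] at h1
    rw [hV]
    nlinarith
  have hw : ∀ s, s ≤ B → profile l s ≤ Real.exp V := fun s hs => Real.exp_le_exp.2 (hv s hs)
  set μ := χ / (2 * t) with hμ
  have hμ0 : 0 < μ := by positivity
  have hμt : μ * t = χ / 2 := by rw [hμ]; field_simp
  -- `M` is the final amplitude, chosen so that the slope stays below `1/2` and `N² ≤ 5/4`. The
  -- growth over time `t` is `e^{μt} = e^{χ/2}`.
  set M := 1 / (2 * l * Real.exp V) with hM
  have hM0 : 0 < M := by positivity
  set a := M * Real.exp (-(χ / 2)) with ha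
  have ha0 : 0 < a := by positivity
  have haM : a * Real.exp (μ * t) = M := by
    rw [hμt, ha, mul_assoc, ← Real.exp_add, neg_add_cancel, Real.exp_zero, mul_one]
  -- The height `k = a e^V` places the initial graph above the plane throughout the cylinder.
  have key := hA.subset_graph hn hf ht htT hz (k := a * Real.exp V) hl0 hχ0 hμ0 ha0 hBB hcyl
    ?_ ?_ ?_ ?_
  · intro p hp
    have h1 := key p hp
    rw [haM] at h1
    have hs := axisDistSq_nonneg c z p
    have h2 : Real.exp 1 ≤ profile l (axisDistSq c z p) := Real.exp_le_exp.2 (one_le_sqrt hs)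
    have h3 : M * Real.exp 1 ≤ M * profile l (axisDistSq c z p) := by gcongr
    -- At time `t` the graph has height at most `k - M e = -M(e - e^{1/4})`, and `e ≥ 2e^{1/4}`
    -- leaves the displacement `M e^{1/4} = R e^{-χ/2} / χ`.
    have h4 : a * Real.exp V = M * Real.exp (1 / 4) := by
      rw [ha, mul_assoc, ← Real.exp_add, hV]
      congr 2
      ring
    have h5 : 2 * Real.exp (1 / 4) ≤ Real.exp 1 := by
      have e1 : (2 : ℝ) ≤ Real.exp (3 / 4) := by
        rw [← Real.log_le_iff_le_exp two_pos]
        linarith [Real.log_two_lt_d9]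
      calc _ ≤ Real.exp (3 / 4) * Real.exp (1 / 4) := by gcongr
        _ = _ := by rw [← Real.exp_add]; norm_num
    have h6 : M * Real.exp (1 / 4) = R * (Real.exp (-(χ / 2)) / χ) := by
      have e1 : Real.exp V = Real.exp (1 / 4) * Real.exp (χ / 2) := by
        rw [← Real.exp_add, hV]
        congr 1
        ring
      rw [hM, e1, hl, Real.exp_neg]
      field_simp
    have h7 : R * (3 : ℝ) ^ (-χ) ≤ R * (Real.exp (-(χ / 2)) / χ) := by
      gcongr
      exact three_rpow_neg_le hχ0
    have h8 : M * (2 * Real.exp (1 / 4)) ≤ M * Real.exp 1 := by gcongr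
    linarith
  · intro s hs
    have hv1 := one_le_sqrt (l := l) hs.1
    have hvV := hv s hs.2
    have hws := profile_pos l s
    rw [two_mul_profileDeriv_add l hs.1]
    unfold profileDeriv
    set v := √(1 + l ^ 2 * s)
    have e1 : χ * (2 * (profile l s * l ^ 2 / (2 * v))) = profile l s * l ^ 2 * (χ / v) := by
      field_simp
    rw [e1]
    gcongr
    have e2 : 1 < χ / v := by
      rw [one_lt_div (by positivity)]
      linarith
    have e3 : v⁻¹ ^ 3 ≤ v⁻¹ ^ 2 :=
      pow_le_pow_of_le_one (by positivity) (inv_le_one_of_one_le₀ hv1) (by norm_num)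
    linarith
  · intro s hs
    rw [haM]
    have hv1 := one_le_sqrt (l := l) hs.1
    have hws := profile_pos l s
    have hwV := hw s hs.2
    have hv2 : √(1 + l ^ 2 * s) ^ 2 = 1 + l ^ 2 * s :=
      Real.sq_sqrt (by have := hs.1; positivity)
    unfold profileDeriv
    set v := √(1 + l ^ 2 * s)
    have e1 : 4 * s * (M * (profile l s * l ^ 2 / (2 * v))) ^ 2 =
        (M * profile l s * l) ^ 2 * ((l ^ 2 * s) / v ^ 2) := by
      field_simp
      ring
    have e2 : l ^ 2 * s / v ^ 2 < 1 := by
      rw [div_lt_one (by positivity), hv2]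
      linarith
    have e3 : (M * profile l s * l) ^ 2 ≤ (M * Real.exp V * l) ^ 2 := by gcongr
    have e4 : M * Real.exp V * l = 1 / 2 := by rw [hM]; field_simp
    rw [e4] at e3
    rw [e1]
    have e5 : 0 < (M * profile l s * l) ^ 2 := by positivity
    have := mul_lt_mul_of_pos_left e2 e5
    linarith
  · intro s hs
    have hws := profile_pos l s
    rw [two_mul_profileDeriv_add l hs.1, hfχ]
    -- After cancelling common factors the speed condition is `5/8 < (3/4)(23/27)`.
    have h1 := le_one_sub_sq_add_cube (inv_nonneg.2 (Real.sqrt_nonneg (1 + l ^ 2 * s)))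
    have e1 : μ * profile l s * (5 / 4) * χ = profile l s * (χ ^ 2 / t) * (5 / 8) := by
      rw [hμ]
      field_simp
      ring
    have e2 : ∀ x, 3 * R ^ 2 / t * (profile l s * l ^ 2 * x) =
        profile l s * (χ ^ 2 / t) * (3 / 4 * x) := fun x => by
      rw [hl]
      field_simp
      ring
    rw [e1, e2]
    gcongr
    linarith
  · intro p hp
    have hs := hcyl 0 ⟨le_rfl, ht.le⟩ p hp
    have h1 := h0 p hp
    have h2 := mul_le_mul_of_nonneg_left (hw _ (hs.trans hBB.le)) ha0.le
    linarith

theorem circumradius_pos (K : Set (Space n)) (hb : Bornology.IsBounded K)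
    (hK : (interior K).Nonempty) : 0 < circumradius K := by
  obtain ⟨p, hp⟩ := hK
  obtain ⟨ε, hε, hball⟩ := Metric.isOpen_iff.1 isOpen_interior p hp
  obtain ⟨z, hz⟩ := exists_norm_eq (Space n) zero_le_one
  obtain ⟨R₀, hR₀, hR₀K⟩ := hb.subset_closedBall_lt 0 0
  refine (half_pos hε).trans_le (le_csInf ⟨R₀, hR₀.le, 0, hR₀K⟩ ?_)
  rintro R ⟨-, c, hc⟩
  have hmem : ∀ s : ℝ, |s| = ε / 2 → ‖p + s • z - c‖ ≤ R := fun s hs => by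
    refine mem_closedBall_iff_norm.1 (hc (interior_subset (hball ?_)))
    rw [mem_ball_iff_norm, add_sub_cancel_left, norm_smul, hz, mul_one, Real.norm_eq_abs, hs]
    linarith
  have h1 := hmem (ε / 2) (abs_of_pos (by positivity))
  have h2 := hmem (-(ε / 2)) (by rw [abs_neg, abs_of_pos (by positivity)])
  have h3 : ‖ε • z‖ ≤ R + R := by
    calc _ = ‖(p + (ε / 2) • z - c) - (p + (-(ε / 2)) • z - c)‖ := by
          congr 1
          module
      _ ≤ _ := (norm_sub_le _ _).trans (add_le_add h1 h2)
  rw [norm_smul, hz, mul_one, Real.norm_of_nonneg hε.le] at h3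
  linarith

theorem exists_subset_closedBall {K : Set (Space n)} (hb : Bornology.IsBounded K) {R : ℝ}
    (hR : circumradius K < R) : ∃ c, K ⊆ Metric.closedBall c R := by
  obtain ⟨R₀, hR₀, hR₀K⟩ := hb.subset_closedBall_lt 0 0
  obtain ⟨R', ⟨-, c, hc⟩, hR'⟩ := exists_lt_of_csInf_lt
    (s := {R : ℝ | 0 ≤ R ∧ ∃ c : Space n, K ⊆ Metric.closedBall c R}) ⟨R₀, hR₀.le, 0, hR₀K⟩ hR
  exact ⟨c, hc.trans (Metric.closedBall_subset_closedBall hR'.le)⟩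

theorem inner_le_supportFn {K : Set (Space n)} (hb : Bornology.IsBounded K) (z : Space n)
    {p : Space n} (hp : p ∈ K) : inner ℝ p z ≤ supportFn K z := by
  refine le_csSup ?_ (mem_image_of_mem _ hp)
  obtain ⟨R, hR⟩ := hb.subset_closedBall 0
  refine ⟨R * ‖z‖, ?_⟩
  rintro _ ⟨q, hq, rfl⟩
  refine (real_inner_le_norm q z).trans ?_
  gcongr
  simpa using hR hq

theorem IsInnerBarrier.supportFn_le (hn : 1 ≤ n) {f : (Fin n → ℝ) → ℝ} (hf : IsSpeed f)
    (hv : DualVanishesOnBoundary f) {A : ℝ → Set (Space n)} {T t : ℝ}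
    (hA : IsInnerBarrier f A (Icc 0 T)) (hb : Bornology.IsBounded (A 0))
    (hint : (interior (A 0)).Nonempty) (ht : 0 < t) (htT : t ≤ T) (hne : (A t).Nonempty) :
    Bornology.IsBounded (A t) ∧ 3 * circumradius (A 0) ^ 2 / t ∈ fhat f '' Ioi 0 ∧
      ∀ z : Space n, ‖z‖ = 1 → supportFn (A t) z ≤ supportFn (A 0) z -
        circumradius (A 0) * (3 : ℝ) ^ (-chi f (3 * circumradius (A 0) ^ 2 / t)) := by
  have hR := circumradius_pos _ hb hint
  set R := circumradius (A 0) with hRdef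
  have h2t : 2 * t ≤ R ^ 2 := by
    refine le_of_forall_gt_imp_ge_of_dense fun x hx => ?_
    have hx0 : 0 < x := (pow_pos hR 2).trans hx
    obtain ⟨c, hc⟩ := exists_subset_closedBall hb (R := √x) (Real.lt_sqrt hR.le |>.2 hx)
    have := hA.two_mul_le_sq hn hf htT hne (Real.sqrt_pos.2 hx0) hc
    rwa [Real.sq_sqrt hx0.le] at this
  have hF : 6 ≤ 3 * R ^ 2 / t := by
    rw [le_div_iff₀ ht]
    linarith
  have hmem := hf.mem_range_fhat hn hv (show 1 ≤ 3 * R ^ 2 / t by linarith)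
  have hχ := hf.le_chi (by linarith) hmem
  obtain ⟨-, hχf⟩ := IsSpeed.chi_spec hmem
  set χ := chi f (3 * R ^ 2 / t)
  have hχ6 : 6 ≤ χ := hF.trans hχ
  -- The slightly larger radius avoids having to attain the infimum defining the circumradius.
  have hR1 : R < R * (1 + 1 / (20 * χ)) := by
    have : 0 < R * (1 / (20 * χ)) := by positivity
    linarith
  obtain ⟨c, hc⟩ := exists_subset_closedBall hb hR1
  have hcτ : ∀ τ ∈ Icc 0 t, A τ ⊆ Metric.closedBall c (R * (1 + 1 / (20 * χ))) := fun τ hτ =>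
    hA.subset_closedBall hn hf hτ.1 (hτ.2.trans htT) (hR.trans hR1) hc
  refine ⟨Metric.isBounded_closedBall.subset (hcτ t ⟨ht.le, le_rfl⟩), hmem, fun z hz => ?_⟩
  -- Sliding the centre along the axis to the supporting plane leaves distances from the axis
  -- unchanged.
  set d := supportFn (A 0) z - inner ℝ c z with hd
  have hheight : ∀ p, inner ℝ z (p - (c + d • z)) = inner ℝ p z - supportFn (A 0) z := fun p => by
    rw [inner_sub_right, inner_add_right, inner_smul_right, real_inner_self_eq_norm_sq, hz,
      real_inner_comm p z, real_inner_comm c z, hd]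
    ring
  have haxis : ∀ p, axisDistSq (c + d • z) z p = axisDistSq c z p := fun p => by
    have : orthComp z (d • z) = 0 := by
      rw [orthComp_apply, inner_smul_right, real_inner_self_eq_norm_sq, hz]
      simp
    unfold axisDistSq
    rw [← sub_sub, map_sub (orthComp z) (p - c), this, sub_zero]
  have key := hA.inner_le_neg hn hf ht htT (c := c + d • z) hz hR hχ6 hχf
    (fun τ hτ p hp => by
      rw [haxis]
      have h1 := axisDistSq_add_sq hz c p
      have h2 := mem_closedBall_iff_norm.1 (hcτ τ hτ hp)
      have h3 : ‖p - c‖ ^ 2 ≤ (R * (1 + 1 / (20 * χ))) ^ 2 := by gcongr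
      linarith [sq_nonneg (inner ℝ z (p - c) : ℝ)])
    (fun p hp => by
      rw [hheight]
      exact sub_nonpos.2 (inner_le_supportFn hb z hp))
  refine csSup_le (hne.image _) ?_
  rintro _ ⟨p, hp, rfl⟩
  have := key p hp
  rw [hheight] at this
  simp only
  linarith

end CurvatureFlow

theorem theorem11 (n : ℕ) (hn : 1 ≤ n) (f : (Fin n → ℝ) → ℝ) (hf : CurvatureFlow.IsSpeed f) :
    (CurvatureFlow.DualVanishesOnBoundary f →
      ∀ (T : ℝ) (Ω : ℝ → Set (CurvatureFlow.Space n)),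
        CurvatureFlow.IsBarrierSolution f Ω (Set.Icc 0 T) →
        Bornology.IsBounded (Ω 0) → Convex ℝ (Ω 0) → (interior (Ω 0)).Nonempty →
        ∀ t : ℝ, 0 < t → t ≤ T → (Ω t).Nonempty →
          Bornology.IsBounded (Ω t) ∧
          3 * CurvatureFlow.circumradius (Ω 0) ^ 2 / t ∈ CurvatureFlow.fhat f '' Set.Ioi 0 ∧
          ∀ z : CurvatureFlow.Space n, ‖z‖ = 1 →
            CurvatureFlow.supportFn (Ω t) z ≤ CurvatureFlow.supportFn (Ω 0) z -
              CurvatureFlow.circumradius (Ω 0) *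
                (3 : ℝ) ^ (-CurvatureFlow.chi f (3 * CurvatureFlow.circumradius (Ω 0) ^ 2 / t)))
    ∧
    (¬ CurvatureFlow.DualVanishesOnBoundary f →
      ∃ C : ℝ, 0 < C ∧
        ∀ (T : ℝ) (Ω : ℝ → Set (CurvatureFlow.Space n)),
          CurvatureFlow.IsBarrierSolution f Ω (Set.Icc 0 T) →
          Bornology.IsBounded (Ω 0) → Convex ℝ (Ω 0) →
          ∀ (z y₀ : CurvatureFlow.Space n) (r : ℝ), ‖z‖ = 1 → 0 < r →
            y₀ ∈ frontier (Ω 0) →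
            inner ℝ y₀ z = CurvatureFlow.supportFn (Ω 0) z →
            Metric.ball y₀ r ∩ {y | inner ℝ y z < CurvatureFlow.supportFn (Ω 0) z} ⊆ Ω 0 →
            ∀ t : ℝ, 0 ≤ t → t ≤ min (C * r ^ 2) T → y₀ ∈ frontier (Ω t)) := by
  refine ⟨fun hv T Ω hΩ hb _ hint t ht htT hne =>
    hΩ.2.supportFn_le hn hf hv hb hint ht htT hne, fun hv => ?_⟩
  obtain ⟨K, hK1, hK⟩ := hf.exists_fhat_le hv
  refine ⟨1 / (16 * K), by positivity, fun T Ω hΩ hb _ z y₀ r hz hr hfr hy₀ hball t ht htle => ?_⟩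
  rcases ht.eq_or_lt with rfl | ht
  · exact hfr
  have hheight : ∀ p, inner ℝ z (p - y₀) = inner ℝ p z - CurvatureFlow.supportFn (Ω 0) z :=
    fun p => by rw [inner_sub_right, real_inner_comm p z, real_inner_comm y₀ z, hy₀]
  refine hΩ.mem_frontier hn hf hK1 hK hb hz hr (fun p hp => ?_) (fun p hp hlt => ?_) ht
    (htle.trans (min_le_right _ _)) ?_
  · rw [hheight]
    exact sub_nonpos.2 (CurvatureFlow.inner_le_supportFn hb z hp)
  · rw [hheight] at hlt
    exact hball ⟨mem_ball_iff_norm.2 hp, sub_neg.1 hlt⟩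
  · have h1 := htle.trans (min_le_left _ _)
    rw [div_mul_eq_mul_div, one_mul, le_div_iff₀ (by positivity)] at h1
    linarith
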